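/- **Setting.** A *PROP* is a symmetric strict monoidal category whose objects are the natural numbers, with monoidal product on objects given by addition; a *morphism of PROPs* is an identity-on-objects strict symmetric monoidal functor. A *signature* $\Sigma$ is a set of generators $o$, each with an arity $n$ and a coarity $m$, written $o : n \to m$. Let $\mathbf{S}_\Sigma$ be the PROP freely generated by $\Sigma$ (with no equations): its arrows $n \to m$ are the terms built from the generators, identities and symmetries by sequential composition and monoidal product, modulo the laws of symmetric strict monoidal categories. A *$\Sigma$-hypergraph* is a finite directed hypergraph in which every hyperedge is labelled by a generator $o : k \to l$ of $\Sigma$ and has an ordered list of $k$ source nodes and an ordered list of $l$ target nodes (repetitions allowed); morphisms preserve labels, sources and targets. A natural number $n$ is regarded as the discrete hypergraph with nodes $0,\dots,n-1$ and no hyperedges. Let $\mathbf{FTerm}_\Sigma$ be the PROP whose arrows $n \to m$ are the isomorphism classes of cospans $n \to G \leftarrow m$ of $\Sigma$-hypergraphs, with composition by pushout, monoidal product by disjoint union, and the evident identities and symmetries. Let $$[\![\cdot]\!] : \mathbf{S}_\Sigma \to \mathbf{FTerm}_\Sigma$$ be the unique morphism of PROPs sending each generator $o : n \to m$ to the cospan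 $n \to G_o \leftarrow m$, where $G_o$ has $n + m$ distinct nodes and a single hyperedge, labelled $o$, whose sources are the first $n$ nodes and whose targets are the last $m$ nodes, in order, and where the two legs are the inclusions of the sources and of the targets. **Proposition.** For every signature $\Sigma$, the morphism $[\![\cdot]\!] : \mathbf{S}_\Sigma \to \mathbf{FTerm}_\Sigma$ is faithful: for all $n, m$ and all arrows $f, g : n \to m$ of $\mathbf{S}_\Sigma$, if $[\![f]\!] = [\![g]\!]$ then $f = g$. -/

import Mathlib

open CategoryTheory

universe u v w

namespace StringDiagram

/-! ## PROPs -/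

/-- Transport of an arrow `a ⟶ b` along equalities `a = a'`, `b = b'` of natural numbers. -/
def recast {Hom : ℕ → ℕ → Type v} {a a' b b' : ℕ} (ha : a = a') (hb : b = b')
    (f : Hom a b) : Hom a' b' :=
  hb ▸ ha ▸ f

/-- A PROP: a symmetric strict monoidal category whose objects are the natural numbers, with
addition as the monoidal product on objects. Composition is written in diagrammatic order.
Strictness means that the associativity and unit isomorphisms are the identities of
`(a + b) + c = a + (b + c)`, `0 + n = n` and `n + 0 = n`. -/
structure PROP where
  Hom : ℕ → ℕ → Type v
  id (n : ℕ) : Hom n n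
  comp {a b c : ℕ} : Hom a b → Hom b c → Hom a c
  tensor {a b c d : ℕ} : Hom a b → Hom c d → Hom (a + c) (b + d)
  symm (n m : ℕ) : Hom (n + m) (m + n)
  id_comp {a b : ℕ} (f : Hom a b) : comp (id a) f = f
  comp_id {a b : ℕ} (f : Hom a b) : comp f (id b) = f
  assoc {a b c d : ℕ} (f : Hom a b) (g : Hom b c) (h : Hom c d) :
    comp (comp f g) h = comp f (comp g h)
  tensor_id (n m : ℕ) : tensor (id n) (id m) = id (n + m)
  interchange {a b c a' b' c' : ℕ} (f : Hom a b) (g : Hom b c) (f' : Hom a' b')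
    (g' : Hom b' c') :
    tensor (comp f g) (comp f' g') = comp (tensor f f') (tensor g g')
  tensor_assoc {a b c a' b' c' : ℕ} (f : Hom a a') (g : Hom b b') (h : Hom c c') :
    recast (Nat.add_assoc a b c) (Nat.add_assoc a' b' c') (tensor (tensor f g) h) =
      tensor f (tensor g h)
  id_zero_tensor {a b : ℕ} (f : Hom a b) :
    recast (Nat.zero_add a) (Nat.zero_add b) (tensor (id 0) f) = f
  tensor_id_zero {a b : ℕ} (f : Hom a b) :
    recast (Nat.add_zero a) (Nat.add_zero b) (tensor f (id 0)) = f
  symm_symm (n m : ℕ) : comp (symm n m) (symm m n) = id (n + m)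
  symm_natural {a b c d : ℕ} (f : Hom a b) (g : Hom c d) :
    comp (tensor f g) (symm b d) = comp (symm a c) (tensor g f)
  hexagon (a b c : ℕ) :
    recast (Nat.add_assoc a b c).symm rfl (symm a (b + c)) =
      comp (tensor (symm a b) (id c))
        (recast (Nat.add_assoc b a c).symm (Nat.add_assoc b c a).symm
          (tensor (id b) (symm a c)))

namespace PROP

/-- A morphism of PROPs: an identity-on-objects strict symmetric monoidal functor. -/
@[ext]
structure Morphism (X : PROP.{v}) (Y : PROP.{w}) where
  map {n m : ℕ} : X.Hom n m → Y.Hom n m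
  map_id (n : ℕ) : map (X.id n) = Y.id n
  map_comp {a b c : ℕ} (f : X.Hom a b) (g : X.Hom b c) :
    map (X.comp f g) = Y.comp (map f) (map g)
  map_tensor {a b c d : ℕ} (f : X.Hom a b) (g : X.Hom c d) :
    map (X.tensor f g) = Y.tensor (map f) (map g)
  map_symm (n m : ℕ) : map (X.symm n m) = Y.symm n m

/-- A morphism of PROPs is faithful if it is injective on each hom-set. -/
def Morphism.Faithful {X : PROP.{v}} {Y : PROP.{w}} (F : Morphism X Y) : Prop :=
  ∀ (n m : ℕ) (f g : X.Hom n m), F.map f = F.map g → f = g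

end PROP

/-! ## Signatures and the freely generated PROP -/

/-- A (one-sorted) monoidal signature: a set of generators with arities and coarities. -/
structure Signature where
  Gen : Type u
  arity : Gen → ℕ
  coarity : Gen → ℕ

/-- Terms over a signature, built from generators, identities and symmetries with sequential
and parallel composition. -/
inductive Term (S : Signature.{u}) : ℕ → ℕ → Type u
  | gen (o : S.Gen) : Term S (S.arity o) (S.coarity o)
  | id (n : ℕ) : Term S n n
  | symm (n m : ℕ) : Term S (n + m) (m + n)
  | comp {a b c : ℕ} (t : Term S a b) (t' : Term S b c) : Term S a c
  | tensor {a b c d : ℕ} (t : Term S a b) (t' : Term S c d) : Term S (a + c) (b + d)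

/-- The smallest congruence on terms containing the laws of symmetric strict monoidal
categories. -/
inductive Term.Eqv {S : Signature.{u}} : {a b : ℕ} → Term S a b → Term S a b → Prop
  | refl {a b : ℕ} (t : Term S a b) : Eqv t t
  | symm {a b : ℕ} {t t' : Term S a b} : Eqv t t' → Eqv t' t
  | trans {a b : ℕ} {t t' t'' : Term S a b} : Eqv t t' → Eqv t' t'' → Eqv t t''
  | comp_congr {a b c : ℕ} {t t' : Term S a b} {s s' : Term S b c} :
      Eqv t t' → Eqv s s' → Eqv (t.comp s) (t'.comp s')
  | tensor_congr {a b c d : ℕ} {t t' : Term S a b} {s s' : Term S c d} :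
      Eqv t t' → Eqv s s' → Eqv (t.tensor s) (t'.tensor s')
  | id_comp {a b : ℕ} (t : Term S a b) : Eqv ((Term.id a).comp t) t
  | comp_id {a b : ℕ} (t : Term S a b) : Eqv (t.comp (Term.id b)) t
  | assoc {a b c d : ℕ} (f : Term S a b) (g : Term S b c) (h : Term S c d) :
      Eqv ((f.comp g).comp h) (f.comp (g.comp h))
  | tensor_id (n m : ℕ) : Eqv ((Term.id n).tensor (Term.id m)) (Term.id (n + m))
  | interchange {a b c a' b' c' : ℕ} (f : Term S a b) (g : Term S b c) (f' : Term S a' b')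
      (g' : Term S b' c') :
      Eqv ((f.comp g).tensor (f'.comp g')) ((f.tensor f').comp (g.tensor g'))
  | tensor_assoc {a b c a' b' c' : ℕ} (f : Term S a a') (g : Term S b b') (h : Term S c c') :
      Eqv (recast (Nat.add_assoc a b c) (Nat.add_assoc a' b' c') ((f.tensor g).tensor h))
        (f.tensor (g.tensor h))
  | id_zero_tensor {a b : ℕ} (f : Term S a b) :
      Eqv (recast (Nat.zero_add a) (Nat.zero_add b) ((Term.id 0).tensor f)) f
  | tensor_id_zero {a b : ℕ} (f : Term S a b) :
      Eqv (recast (Nat.add_zero a) (Nat.add_zero b) (f.tensor (Term.id 0))) f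
  | symm_symm (n m : ℕ) :
      Eqv ((Term.symm n m).comp (Term.symm m n)) (Term.id (n + m))
  | symm_natural {a b c d : ℕ} (f : Term S a b) (g : Term S c d) :
      Eqv ((f.tensor g).comp (Term.symm b d)) ((Term.symm a c).comp (g.tensor f))
  | hexagon (a b c : ℕ) :
      Eqv (recast (Nat.add_assoc a b c).symm rfl (Term.symm a (b + c)))
        (((Term.symm a b).tensor (Term.id c)).comp
          (recast (Nat.add_assoc b a c).symm (Nat.add_assoc b c a).symm
            ((Term.id b).tensor (Term.symm a c))))

/-- The setoid of terms modulo the laws of symmetric strict monoidal categories. -/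
instance Term.setoid (S : Signature.{u}) (a b : ℕ) : Setoid (Term S a b) where
  r := Term.Eqv
  iseqv := ⟨Term.Eqv.refl, Term.Eqv.symm, Term.Eqv.trans⟩

/-- Arrows of the freely generated PROP. -/
def FreeHom (S : Signature.{u}) (a b : ℕ) : Type u := Quotient (Term.setoid S a b)

/-- The class of a term. -/
def FreeHom.mk {S : Signature.{u}} {a b : ℕ} (t : Term S a b) : FreeHom S a b :=
  Quotient.mk (Term.setoid S a b) t

theorem FreeHom.sound {S : Signature.{u}} {a b : ℕ} {t t' : Term S a b} (h : t.Eqv t') :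
    FreeHom.mk t = FreeHom.mk t' :=
  Quotient.sound h

theorem FreeHom.recast_mk {S : Signature.{u}} {a a' b b' : ℕ} (ha : a = a') (hb : b = b')
    (t : Term S a b) :
    recast (Hom := FreeHom S) ha hb (FreeHom.mk t) = FreeHom.mk (recast ha hb t) := by
  subst ha hb; rfl

/-- The PROP `S_Σ` freely generated by the signature `Σ` and no equations. -/
def freeProp (S : Signature.{u}) : PROP.{u} where
  Hom := FreeHom S
  id n := FreeHom.mk (Term.id n)
  comp := Quotient.map₂ Term.comp (fun _ _ h _ _ h' => Term.Eqv.comp_congr h h')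
  tensor := Quotient.map₂ Term.tensor (fun _ _ h _ _ h' => Term.Eqv.tensor_congr h h')
  symm n m := FreeHom.mk (Term.symm n m)
  id_comp := by
    rintro a b ⟨f⟩; exact FreeHom.sound (Term.Eqv.id_comp f)
  comp_id := by
    rintro a b ⟨f⟩; exact FreeHom.sound (Term.Eqv.comp_id f)
  assoc := by
    rintro a b c d ⟨f⟩ ⟨g⟩ ⟨h⟩; exact FreeHom.sound (Term.Eqv.assoc f g h)
  tensor_id n m := FreeHom.sound (Term.Eqv.tensor_id n m)
  interchange := by
    rintro a b c a' b' c' ⟨f⟩ ⟨g⟩ ⟨f'⟩ ⟨g'⟩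
    exact FreeHom.sound (Term.Eqv.interchange f g f' g')
  tensor_assoc := by
    rintro a b c a' b' c' ⟨f⟩ ⟨g⟩ ⟨h⟩
    exact (FreeHom.recast_mk _ _ _).trans (FreeHom.sound (Term.Eqv.tensor_assoc f g h))
  id_zero_tensor := by
    rintro a b ⟨f⟩
    exact (FreeHom.recast_mk _ _ _).trans (FreeHom.sound (Term.Eqv.id_zero_tensor f))
  tensor_id_zero := by
    rintro a b ⟨f⟩
    exact (FreeHom.recast_mk _ _ _).trans (FreeHom.sound (Term.Eqv.tensor_id_zero f))
  symm_symm n m := FreeHom.sound (Term.Eqv.symm_symm n m)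
  symm_natural := by
    rintro a b c d ⟨f⟩ ⟨g⟩; exact FreeHom.sound (Term.Eqv.symm_natural f g)
  hexagon a b c := by
    rw [FreeHom.recast_mk]
    refine (FreeHom.sound (Term.Eqv.hexagon a b c)).trans ?_
    exact (congrArg (Quotient.map₂ Term.comp (fun _ _ h _ _ h' => Term.Eqv.comp_congr h h')
      (FreeHom.mk ((Term.symm a b).tensor (Term.id c)))) (FreeHom.recast_mk _ _ _)).symm

/-- A generator, as an arrow of the free PROP. -/
def freeGen {S : Signature.{u}} (o : S.Gen) :
    (freeProp S).Hom (S.arity o) (S.coarity o) :=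
  FreeHom.mk (Term.gen o)

section Lift

variable {S : Signature.{u}} (X : PROP.{v})
  (φ : (o : S.Gen) → X.Hom (S.arity o) (S.coarity o))

/-- Evaluation of terms in a PROP, given an interpretation of the generators. -/
def Term.eval : {a b : ℕ} → Term S a b → X.Hom a b
  | _, _, .gen o => φ o
  | _, _, .id n => X.id n
  | _, _, .symm n m => X.symm n m
  | _, _, .comp t t' => X.comp (Term.eval t) (Term.eval t')
  | _, _, .tensor t t' => X.tensor (Term.eval t) (Term.eval t')

theorem Term.eval_recast {a a' b b' : ℕ} (ha : a = a') (hb : b = b') (t : Term S a b) :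
    Term.eval X φ (recast ha hb t) = recast ha hb (Term.eval X φ t) := by
  subst ha hb; rfl

theorem Term.eval_sound {a b : ℕ} {t t' : Term S a b} (h : t.Eqv t') :
    Term.eval X φ t = Term.eval X φ t' := by
  induction h with
  | refl t => rfl
  | symm _ ih => exact ih.symm
  | trans _ _ ih ih' => exact ih.trans ih'
  | comp_congr _ _ ih ih' => simp only [Term.eval, ih, ih']
  | tensor_congr _ _ ih ih' => simp only [Term.eval, ih, ih']
  | id_comp t => exact X.id_comp _
  | comp_id t => exact X.comp_id _
  | assoc f g h => exact X.assoc _ _ _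
  | tensor_id n m => exact X.tensor_id _ _
  | interchange f g f' g' => exact X.interchange _ _ _ _
  | tensor_assoc f g h => rw [Term.eval_recast]; exact X.tensor_assoc _ _ _
  | id_zero_tensor f => rw [Term.eval_recast]; exact X.id_zero_tensor _
  | tensor_id_zero f => rw [Term.eval_recast]; exact X.tensor_id_zero _
  | symm_symm n m => exact X.symm_symm _ _
  | symm_natural f g => exact X.symm_natural _ _
  | hexagon a b c =>
    rw [Term.eval_recast]
    simp only [Term.eval]
    rw [Term.eval_recast]
    exact X.hexagon a b c

/-- The PROP morphism out of the free PROP determined by the images of the generators. -/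
def freeLift : PROP.Morphism (freeProp S) X where
  map := Quotient.lift (Term.eval X φ) (fun _ _ h => Term.eval_sound X φ h)
  map_id _ := rfl
  map_comp := by rintro a b c ⟨f⟩ ⟨g⟩; rfl
  map_tensor := by rintro a b c d ⟨f⟩ ⟨g⟩; rfl
  map_symm _ _ := rfl

theorem freeLift_gen (o : S.Gen) : (freeLift X φ).map (freeGen o) = φ o := rfl

/-- A PROP morphism out of the free PROP is determined by the images of the generators. -/
theorem freeProp_hom_ext {X : PROP.{v}} (F G : PROP.Morphism (freeProp S) X)
    (h : ∀ o : S.Gen, F.map (freeGen o) = G.map (freeGen o)) : F = G := by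
  have key : ∀ {a b : ℕ} (t : Term S a b),
      F.map (X := freeProp S) (FreeHom.mk t) = G.map (X := freeProp S) (FreeHom.mk t) := by
    intro a b t
    induction t with
    | gen o => exact h o
    | id n => exact (F.map_id n).trans (G.map_id n).symm
    | symm n m => exact (F.map_symm n m).trans (G.map_symm n m).symm
    | comp t t' ih ih' =>
      refine (F.map_comp (FreeHom.mk t) (FreeHom.mk t')).trans
        (Eq.trans ?_ (G.map_comp (FreeHom.mk t) (FreeHom.mk t')).symm)
      rw [ih, ih']
    | tensor t t' ih ih' =>
      refine (F.map_tensor (FreeHom.mk t) (FreeHom.mk t')).trans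
        (Eq.trans ?_ (G.map_tensor (FreeHom.mk t) (FreeHom.mk t')).symm)
      rw [ih, ih']
  ext n m f
  obtain ⟨t⟩ := f
  exact key t

end Lift

/-! ## Hypergraphs over a signature -/

/-- A finite directed hypergraph typed over a signature: each hyperedge is labelled by a
generator, and its ordered lists of source and target nodes have as lengths the arity and the
coarity of the label. This is an object of the slice of finite hypergraphs over the signature,
seen as a hypergraph with one node. -/
structure Hyp (S : Signature.{u}) where
  Node : Type
  Edge : Type
  [finite_node : Finite Node]
  [finite_edge : Finite Edge]
  label : Edge → S.Gen
  src : Edge → List Node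
  tgt : Edge → List Node
  length_src (e : Edge) : (src e).length = S.arity (label e)
  length_tgt (e : Edge) : (tgt e).length = S.coarity (label e)

attribute [instance] Hyp.finite_node Hyp.finite_edge

namespace Hyp

variable {S : Signature.{u}}

/-- A morphism of hypergraphs over a signature. -/
@[ext]
structure Hom (G H : Hyp S) where
  node : G.Node → H.Node
  edge : G.Edge → H.Edge
  label_edge (e : G.Edge) : H.label (edge e) = G.label e
  src_edge (e : G.Edge) : H.src (edge e) = (G.src e).map node
  tgt_edge (e : G.Edge) : H.tgt (edge e) = (G.tgt e).map node

instance : Category (Hyp S) where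
  Hom := Hom
  id G := ⟨fun x => x, fun e => e, fun _ => rfl, fun _ => by simp, fun _ => by simp⟩
  comp f g :=
    { node := fun x => g.node (f.node x)
      edge := fun e => g.edge (f.edge e)
      label_edge := fun e => by rw [g.label_edge, f.label_edge]
      src_edge := fun e => by rw [g.src_edge, f.src_edge, List.map_map]; rfl
      tgt_edge := fun e => by rw [g.tgt_edge, f.tgt_edge, List.map_map]; rfl }

theorem hom_ext {G H : Hyp S} {f g : G ⟶ H} (hn : ∀ x, Hom.node f x = Hom.node g x)
    (he : ∀ e, Hom.edge f e = Hom.edge g e) : f = g :=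
  Hom.ext (funext hn) (funext he)

@[simp] theorem id_node (G : Hyp S) (x : G.Node) : Hom.node (𝟙 G) x = x := rfl
@[simp] theorem id_edge (G : Hyp S) (x : G.Edge) : Hom.edge (𝟙 G) x = x := rfl
@[simp] theorem comp_node {G H K : Hyp S} (f : G ⟶ H) (g : H ⟶ K) (x : G.Node) :
    Hom.node (f ≫ g) x = Hom.node g (Hom.node f x) := rfl
@[simp] theorem comp_edge {G H K : Hyp S} (f : G ⟶ H) (g : H ⟶ K) (x : G.Edge) :
    Hom.edge (f ≫ g) x = Hom.edge g (Hom.edge f x) := rfl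

/-- The discrete hypergraph with `n` nodes (and no hyperedges). -/
def discrete (S : Signature.{u}) (n : ℕ) : Hyp S where
  Node := Fin n
  Edge := Empty
  label := Empty.elim
  src := Empty.elim
  tgt := Empty.elim
  length_src e := e.elim
  length_tgt e := e.elim

/-- A function into the nodes of `G`, as a morphism from a discrete hypergraph. -/
def ofFun {n : ℕ} {G : Hyp S} (f : Fin n → G.Node) : discrete S n ⟶ G where
  node := f
  edge := Empty.elim
  label_edge e := e.elim
  src_edge e := e.elim
  tgt_edge e := e.elim

theorem discrete_hom_ext {n : ℕ} {G : Hyp S} {f g : discrete S n ⟶ G}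
    (h : ∀ i : Fin n, Hom.node f i = Hom.node g i) : f = g :=
  hom_ext h (fun e => Empty.elim e)

/-- The disjoint union of two hypergraphs. -/
def sum (G H : Hyp S) : Hyp S where
  Node := G.Node ⊕ H.Node
  Edge := G.Edge ⊕ H.Edge
  label := Sum.elim G.label H.label
  src := Sum.elim (fun e => (G.src e).map Sum.inl) (fun e => (H.src e).map Sum.inr)
  tgt := Sum.elim (fun e => (G.tgt e).map Sum.inl) (fun e => (H.tgt e).map Sum.inr)
  length_src := by rintro (e | e) <;> simp [length_src]
  length_tgt := by rintro (e | e) <;> simp [length_tgt]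

/-- The relation identifying the images in `G` and `H` of each node of `K`. -/
inductive GlueRel {K G H : Hyp S} (p : K ⟶ G) (q : K ⟶ H) :
    G.Node ⊕ H.Node → G.Node ⊕ H.Node → Prop
  | mk (i : K.Node) : GlueRel p q (Sum.inl (Hom.node p i)) (Sum.inr (Hom.node q i))

/-- The pushout of two hypergraphs along a discrete one: the nodes of `G` and `H` are glued
along the nodes of `discrete S n`, and the hyperedges are those of `G` and of `H`. -/
def glue {n : ℕ} {G H : Hyp S} (p : discrete S n ⟶ G) (q : discrete S n ⟶ H) : Hyp S where
  Node := Quot (GlueRel p q)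
  Edge := G.Edge ⊕ H.Edge
  label := Sum.elim G.label H.label
  src := Sum.elim (fun e => (G.src e).map fun x => Quot.mk _ (Sum.inl x))
    (fun e => (H.src e).map fun x => Quot.mk _ (Sum.inr x))
  tgt := Sum.elim (fun e => (G.tgt e).map fun x => Quot.mk _ (Sum.inl x))
    (fun e => (H.tgt e).map fun x => Quot.mk _ (Sum.inr x))
  length_src := by rintro (e | e) <;> simp [length_src]
  length_tgt := by rintro (e | e) <;> simp [length_tgt]

section Sum

variable {G H K : Hyp S}

/-- The first injection into the disjoint union. -/
def sumInl (G H : Hyp S) : G ⟶ sum G H where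
  node := Sum.inl
  edge := Sum.inl
  label_edge _ := rfl
  src_edge _ := rfl
  tgt_edge _ := rfl

/-- The second injection into the disjoint union. -/
def sumInr (G H : Hyp S) : H ⟶ sum G H where
  node := Sum.inr
  edge := Sum.inr
  label_edge _ := rfl
  src_edge _ := rfl
  tgt_edge _ := rfl

/-- The morphism out of a disjoint union determined by its two components. -/
def sumDesc (f : G ⟶ K) (g : H ⟶ K) : sum G H ⟶ K where
  node := Sum.elim (Hom.node f) (Hom.node g)
  edge := Sum.elim (Hom.edge f) (Hom.edge g)
  label_edge := by
    rintro (e | e)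
    · exact Hom.label_edge f e
    · exact Hom.label_edge g e
  src_edge := by
    rintro (e | e)
    · exact (Hom.src_edge f e).trans (by simp [sum, Function.comp_def])
    · exact (Hom.src_edge g e).trans (by simp [sum, Function.comp_def])
  tgt_edge := by
    rintro (e | e)
    · exact (Hom.tgt_edge f e).trans (by simp [sum, Function.comp_def])
    · exact (Hom.tgt_edge g e).trans (by simp [sum, Function.comp_def])

@[simp] theorem sumInl_desc (f : G ⟶ K) (g : H ⟶ K) :
    sumInl G H ≫ sumDesc f g = f := rfl

@[simp] theorem sumInr_desc (f : G ⟶ K) (g : H ⟶ K) :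
    sumInr G H ≫ sumDesc f g = g := rfl

@[simp] theorem sumInl_desc_assoc {L : Hyp S} (f : G ⟶ K) (g : H ⟶ K) (k : K ⟶ L) :
    sumInl G H ≫ sumDesc f g ≫ k = f ≫ k := rfl

@[simp] theorem sumInr_desc_assoc {L : Hyp S} (f : G ⟶ K) (g : H ⟶ K) (k : K ⟶ L) :
    sumInr G H ≫ sumDesc f g ≫ k = g ≫ k := rfl

theorem sum_hom_ext {f g : sum G H ⟶ K} (hl : sumInl G H ≫ f = sumInl G H ≫ g)
    (hr : sumInr G H ≫ f = sumInr G H ≫ g) : f = g := by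
  apply hom_ext
  · rintro (x | x)
    · exact congrFun (congrArg Hom.node hl) x
    · exact congrFun (congrArg Hom.node hr) x
  · rintro (x | x)
    · exact congrFun (congrArg Hom.edge hl) x
    · exact congrFun (congrArg Hom.edge hr) x

/-- The disjoint union of two morphisms. -/
def sumMap {G' H' : Hyp S} (f : G ⟶ G') (g : H ⟶ H') : sum G H ⟶ sum G' H' :=
  sumDesc (f ≫ sumInl G' H') (g ≫ sumInr G' H')

end Sum

section Glue

variable {n : ℕ} {G H : Hyp S} (p : discrete S n ⟶ G) (q : discrete S n ⟶ H)

/-- The first leg of the pushout square. -/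
def glueInl : G ⟶ glue p q where
  node x := Quot.mk _ (Sum.inl x)
  edge := Sum.inl
  label_edge _ := rfl
  src_edge _ := rfl
  tgt_edge _ := rfl

/-- The second leg of the pushout square. -/
def glueInr : H ⟶ glue p q where
  node x := Quot.mk _ (Sum.inr x)
  edge := Sum.inr
  label_edge _ := rfl
  src_edge _ := rfl
  tgt_edge _ := rfl

/-- The gluing is the pushout in the category of hypergraphs over the signature. -/
theorem isPushout_glue : IsPushout p q (glueInl p q) (glueInr p q) := by
  refine IsPushout.mk' ?_ ?_ ?_
  · exact discrete_hom_ext fun i => Quot.sound (GlueRel.mk (p := p) (q := q) i)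
  · intro T φ φ' hl hr
    apply hom_ext
    · rintro ⟨x | x⟩
      · exact congrFun (congrArg Hom.node hl) x
      · exact congrFun (congrArg Hom.node hr) x
    · rintro (x | x)
      · exact congrFun (congrArg Hom.edge hl) x
      · exact congrFun (congrArg Hom.edge hr) x
  · intro T a b h
    refine ⟨⟨Quot.lift (Sum.elim (Hom.node a) (Hom.node b)) ?_,
      Sum.elim (Hom.edge a) (Hom.edge b), ?_, ?_, ?_⟩, rfl, rfl⟩
    · rintro _ _ ⟨i⟩
      exact congrFun (congrArg Hom.node h) i
    · rintro (e | e)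
      · exact Hom.label_edge a e
      · exact Hom.label_edge b e
    · rintro (e | e)
      · exact (Hom.src_edge a e).trans (by simp [glue, Function.comp_def])
      · exact (Hom.src_edge b e).trans (by simp [glue, Function.comp_def])
    · rintro (e | e)
      · exact (Hom.tgt_edge a e).trans (by simp [glue, Function.comp_def])
      · exact (Hom.tgt_edge b e).trans (by simp [glue, Function.comp_def])

end Glue

/-- The inclusion of the first `n` nodes of `discrete S (n + m)`. -/
def blockL (S : Signature.{u}) (n m : ℕ) : discrete S n ⟶ discrete S (n + m) :=
  ofFun (Fin.castAdd m)

/-- The inclusion of the last `m` nodes of `discrete S (n + m)`. -/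
def blockR (S : Signature.{u}) (n m : ℕ) : discrete S m ⟶ discrete S (n + m) :=
  ofFun (Fin.natAdd n)

/-- `discrete S (n + m)` is the coproduct of `discrete S n` and `discrete S m`. -/
def copair {n m : ℕ} {G : Hyp S} (f : discrete S n ⟶ G) (g : discrete S m ⟶ G) :
    discrete S (n + m) ⟶ G :=
  ofFun (Fin.addCases (Hom.node f) (Hom.node g))

@[simp] theorem blockL_copair {n m : ℕ} {G : Hyp S} (f : discrete S n ⟶ G)
    (g : discrete S m ⟶ G) : blockL S n m ≫ copair f g = f :=
  discrete_hom_ext fun i => Fin.addCases_left (motive := fun _ => G.Node) i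

@[simp] theorem blockR_copair {n m : ℕ} {G : Hyp S} (f : discrete S n ⟶ G)
    (g : discrete S m ⟶ G) : blockR S n m ≫ copair f g = g :=
  discrete_hom_ext fun i => Fin.addCases_right (motive := fun _ => G.Node) i

@[simp] theorem blockL_copair_assoc {n m : ℕ} {G L : Hyp S} (f : discrete S n ⟶ G)
    (g : discrete S m ⟶ G) (k : G ⟶ L) : blockL S n m ≫ copair f g ≫ k = f ≫ k := by
  rw [← Category.assoc, blockL_copair]

@[simp] theorem blockR_copair_assoc {n m : ℕ} {G L : Hyp S} (f : discrete S n ⟶ G)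
    (g : discrete S m ⟶ G) (k : G ⟶ L) : blockR S n m ≫ copair f g ≫ k = g ≫ k := by
  rw [← Category.assoc, blockR_copair]

theorem block_hom_ext {n m : ℕ} {G : Hyp S} {f g : discrete S (n + m) ⟶ G}
    (hl : blockL S n m ≫ f = blockL S n m ≫ g) (hr : blockR S n m ≫ f = blockR S n m ≫ g) :
    f = g := by
  refine discrete_hom_ext fun i => ?_
  refine Fin.addCases (fun j => ?_) (fun j => ?_) i
  · exact congrFun (congrArg Hom.node hl) j
  · exact congrFun (congrArg Hom.node hr) j

/-- The bijection exchanging the two blocks. -/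
def swap (S : Signature.{u}) (n m : ℕ) : discrete S (n + m) ⟶ discrete S (m + n) :=
  copair (blockR S m n) (blockL S m n)

theorem swap_swap (n m : ℕ) : swap S n m ≫ swap S m n = 𝟙 _ := by
  apply block_hom_ext <;> simp [swap]

end Hyp

/-! ## Frobenius termgraphs -/

/-- A cospan `n ⟶ G ⟵ m` of hypergraphs with discrete feet. -/
structure Cospan (S : Signature.{u}) (n m : ℕ) where
  apex : Hyp S
  left : Hyp.discrete S n ⟶ apex
  right : Hyp.discrete S m ⟶ apex

namespace Cospan

open Hyp

variable {S : Signature.{u}}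

/-- Isomorphism of cospans. -/
def Equiv {n m : ℕ} (c d : Cospan S n m) : Prop :=
  ∃ φ : c.apex ≅ d.apex, c.left ≫ φ.hom = d.left ∧ c.right ≫ φ.hom = d.right

instance setoid (S : Signature.{u}) (n m : ℕ) : Setoid (Cospan S n m) where
  r := Equiv
  iseqv :=
    { refl := fun c => ⟨Iso.refl _, by simp, by simp⟩
      symm := by
        rintro c d ⟨φ, hl, hr⟩
        exact ⟨φ.symm, by simp [← hl], by simp [← hr]⟩
      trans := by
        rintro c d e ⟨φ, hl, hr⟩ ⟨ψ, hl', hr'⟩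
        exact ⟨φ ≪≫ ψ, by rw [Iso.trans_hom, reassoc_of% hl, hl'],
          by rw [Iso.trans_hom, reassoc_of% hr, hr']⟩ }

/-- The identity cospan. -/
abbrev id (S : Signature.{u}) (n : ℕ) : Cospan S n n := ⟨discrete S n, 𝟙 _, 𝟙 _⟩

/-- Composition of cospans, by pushout. -/
abbrev comp {a b c : ℕ} (x : Cospan S a b) (y : Cospan S b c) : Cospan S a c where
  apex := glue x.right y.left
  left := x.left ≫ glueInl x.right y.left
  right := y.right ≫ glueInr x.right y.left

/-- The monoidal product of cospans, by disjoint union. -/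
abbrev tensor {a b c d : ℕ} (x : Cospan S a b) (y : Cospan S c d) : Cospan S (a + c) (b + d) where
  apex := sum x.apex y.apex
  left := copair (x.left ≫ sumInl _ _) (y.left ≫ sumInr _ _)
  right := copair (x.right ≫ sumInl _ _) (y.right ≫ sumInr _ _)

/-- The symmetry: input port `i` of the first block is output port `m + i`, and input port
`n + j` is output port `j`. -/
abbrev symm (S : Signature.{u}) (n m : ℕ) : Cospan S (n + m) (m + n) :=
  ⟨discrete S (m + n), swap S n m, 𝟙 _⟩

/-- The cospan of a generator `o`: a single hyperedge labelled `o`, whose source and target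
nodes are pairwise distinct, with the sources as inputs and the targets as outputs. -/
def gen (o : S.Gen) : Cospan S (S.arity o) (S.coarity o) where
  apex :=
    { Node := Fin (S.arity o) ⊕ Fin (S.coarity o)
      Edge := Unit
      label := fun _ => o
      src := fun _ => List.ofFn Sum.inl
      tgt := fun _ => List.ofFn Sum.inr
      length_src := fun _ => List.length_ofFn
      length_tgt := fun _ => List.length_ofFn }
  left := ofFun Sum.inl
  right := ofFun Sum.inr

/-- Composition may be computed with any pushout. -/
theorem comp_equiv_of_isPushout {a b c : ℕ} (x : Cospan S a b) (y : Cospan S b c)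
    (z : Cospan S a c) {i : x.apex ⟶ z.apex} {j : y.apex ⟶ z.apex}
    (h : IsPushout x.right y.left i j) (hl : x.left ≫ i = z.left) (hr : y.right ≫ j = z.right) :
    Equiv (comp x y) z :=
  ⟨(isPushout_glue x.right y.left).isoIsPushout _ _ h, by simp [hl], by simp [hr]⟩

theorem comp_congr {a b c : ℕ} {x x' : Cospan S a b} {y y' : Cospan S b c} (hx : Equiv x x')
    (hy : Equiv y y') : Equiv (comp x y) (comp x' y') := by
  obtain ⟨φ, hl, hr⟩ := hx
  obtain ⟨ψ, kl, kr⟩ := hy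
  have h : IsPushout x.right y.left (φ.hom ≫ glueInl x'.right y'.left)
      (ψ.hom ≫ glueInr x'.right y'.left) :=
    (isPushout_glue x'.right y'.left).of_iso' (Iso.refl _) φ ψ (Iso.refl _)
      (by simp [hr]) (by simp [kl]) (by simp) (by simp)
  exact comp_equiv_of_isPushout x y (comp x' y') h (by simp [← hl]) (by simp [← kr])

theorem id_comp {a b : ℕ} (x : Cospan S a b) : Equiv (comp (id S a) x) x := 
  comp_equiv_of_isPushout (id S a) x x (IsPushout.id_horiz x.left) (by simp) (by simp)

theorem comp_id {a b : ℕ} (x : Cospan S a b) : Equiv (comp x (id S b)) x := 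
  comp_equiv_of_isPushout x (id S b) x (IsPushout.id_vert x.right) (by simp) (by simp)

theorem assoc {a b c d : ℕ} (x : Cospan S a b) (y : Cospan S b c) (z : Cospan S c d) :
    Equiv (comp (comp x y) z) (comp x (comp y z)) := by
  have h₁ := isPushout_glue x.right y.left
  have h₂ := isPushout_glue y.right z.left
  have h₃ := isPushout_glue (y.right ≫ glueInr x.right y.left) z.left
  obtain ⟨l, hl₁, hl₂⟩ := h₂.exists_desc
    (glueInr x.right y.left ≫ glueInl (y.right ≫ glueInr x.right y.left) z.left)
    (glueInr (y.right ≫ glueInr x.right y.left) z.left) (by simpa using h₃.w)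
  have h₄ : IsPushout (glueInr x.right y.left) (glueInl y.right z.left)
      (glueInl (y.right ≫ glueInr x.right y.left) z.left) l := by
    refine IsPushout.of_left (h₁₁ := y.right) (v₁₁ := z.left)
      (h₂₁ := glueInr y.right z.left) ?_ hl₁.symm h₂
    rw [hl₂]
    exact h₃
  refine Setoid.symm (α := Cospan S a d)
    (comp_equiv_of_isPushout x (comp y z) (comp (comp x y) z) (h₁.paste_vert h₄) ?_ ?_)
  · simp
  · simp [hl₂]

theorem tensor_congr {a b c d : ℕ} {x x' : Cospan S a b} {y y' : Cospan S c d}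
    (hx : Equiv x x') (hy : Equiv y y') : Equiv (tensor x y) (tensor x' y') := by
  obtain ⟨φ, hl, hr⟩ := hx
  obtain ⟨ψ, kl, kr⟩ := hy
  refine ⟨⟨sumMap φ.hom ψ.hom, sumMap φ.inv ψ.inv, ?_, ?_⟩, ?_, ?_⟩
  · apply sum_hom_ext <;> simp [sumMap, tensor]
  · apply sum_hom_ext <;> simp [sumMap, tensor]
  · apply block_hom_ext <;> simp [sumMap, tensor, ← hl, ← kl]
  · apply block_hom_ext <;> simp [sumMap, tensor, ← hr, ← kr]

theorem isPushout_sum {b b' : ℕ} {G H P G' H' P' : Hyp S} {p : discrete S b ⟶ G}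
    {q : discrete S b ⟶ H} {i : G ⟶ P} {j : H ⟶ P} {p' : discrete S b' ⟶ G'}
    {q' : discrete S b' ⟶ H'} {i' : G' ⟶ P'} {j' : H' ⟶ P'} (h : IsPushout p q i j)
    (h' : IsPushout p' q' i' j') :
    IsPushout (copair (p ≫ sumInl G G') (p' ≫ sumInr G G'))
      (copair (q ≫ sumInl H H') (q' ≫ sumInr H H')) (sumMap i i') (sumMap j j') := by
  refine IsPushout.mk' ?_ ?_ ?_
  · apply block_hom_ext <;> simp [sumMap, h.w_assoc, h'.w_assoc]
  · intro T φ φ' hl hr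
    apply sum_hom_ext
    · apply h.hom_ext
      · simpa [sumMap] using congrArg (fun f => sumInl G G' ≫ f) hl
      · simpa [sumMap] using congrArg (fun f => sumInl H H' ≫ f) hr
    · apply h'.hom_ext
      · simpa [sumMap] using congrArg (fun f => sumInr G G' ≫ f) hl
      · simpa [sumMap] using congrArg (fun f => sumInr H H' ≫ f) hr
  · intro T f g w
    obtain ⟨l, l₁, l₂⟩ := h.exists_desc (sumInl G G' ≫ f) (sumInl H H' ≫ g)
      (by simpa using congrArg (fun f => blockL S b b' ≫ f) w)
    obtain ⟨r, r₁, r₂⟩ := h'.exists_desc (sumInr G G' ≫ f) (sumInr H H' ≫ g)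
      (by simpa using congrArg (fun f => blockR S b b' ≫ f) w)
    refine ⟨sumDesc l r, ?_, ?_⟩
    · apply sum_hom_ext <;> simp [sumMap, l₁, r₁]
    · apply sum_hom_ext <;> simp [sumMap, l₂, r₂]

theorem interchange {a b c a' b' c' : ℕ} (x : Cospan S a b) (y : Cospan S b c)
    (x' : Cospan S a' b') (y' : Cospan S b' c') :
    Equiv (tensor (comp x y) (comp x' y')) (comp (tensor x x') (tensor y y')) := by
  refine Setoid.symm (α := Cospan S (a + a') (c + c'))
    (comp_equiv_of_isPushout (tensor x x') (tensor y y') (tensor (comp x y) (comp x' y'))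
      (isPushout_sum (isPushout_glue x.right y.left) (isPushout_glue x'.right y'.left)) ?_ ?_)
  · apply block_hom_ext <;> simp [sumMap]
  · apply block_hom_ext <;> simp [sumMap]

/-- The cospan `(f, 𝟙)`. -/
abbrev ofMap {n m : ℕ} (f : discrete S n ⟶ discrete S m) : Cospan S n m := ⟨discrete S m, f, 𝟙 _⟩

theorem ofMap_comp {a b c : ℕ} (f : discrete S a ⟶ discrete S b) (y : Cospan S b c) :
    Equiv (comp (ofMap f) y) ⟨y.apex, f ≫ y.left, y.right⟩ := 
  comp_equiv_of_isPushout (ofMap f) y ⟨y.apex, f ≫ y.left, y.right⟩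
    (IsPushout.id_horiz y.left) (by simp) (by simp)

theorem comp_symm {a b c : ℕ} (x : Cospan S a (b + c)) :
    Equiv (comp x (symm S b c)) ⟨x.apex, x.left, swap S c b ≫ x.right⟩ := by
  have h : IsPushout x.right (symm S b c).left (𝟙 _) (swap S c b ≫ x.right) :=
    (IsPushout.id_vert x.right).of_iso' (Iso.refl _) (Iso.refl _)
      ⟨swap S c b, swap S b c, swap_swap _ _, swap_swap _ _⟩ (Iso.refl _)
      (by simp) (by simp [symm, swap_swap]) (by simp) (by simp)
  exact comp_equiv_of_isPushout x (symm S b c) ⟨x.apex, x.left, swap S c b ≫ x.right⟩ h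
    (by simp) (by simp)

theorem tensor_ofMap {a b c d : ℕ} (f : discrete S a ⟶ discrete S b)
    (g : discrete S c ⟶ discrete S d) :
    Equiv (tensor (ofMap f) (ofMap g)) (ofMap (copair (f ≫ blockL S b d) (g ≫ blockR S b d))) := by
  refine ⟨⟨sumDesc (blockL S b d) (blockR S b d), copair (sumInl _ _) (sumInr _ _), ?_, ?_⟩,
    ?_, ?_⟩
  · apply sum_hom_ext <;> simp [ofMap, tensor]
  · apply block_hom_ext <;> simp [ofMap]
  · apply block_hom_ext <;> simp [ofMap, tensor]
  · apply block_hom_ext <;> simp [ofMap, tensor]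

theorem tensor_id (n m : ℕ) : Equiv (tensor (id S n) (id S m)) (id S (n + m)) := by
  have h := tensor_ofMap (𝟙 (discrete S n)) (𝟙 (discrete S m))
  have e : copair (𝟙 _ ≫ blockL S n m) (𝟙 _ ≫ blockR S n m) = 𝟙 (discrete S (n + m)) := by
    apply block_hom_ext <;> simp
  rw [e] at h
  exact h

theorem symm_symm (n m : ℕ) : Equiv (comp (symm S n m) (symm S m n)) (id S (n + m)) := by
  have h := ofMap_comp (swap S n m) (symm S m n)
  have e : swap S n m ≫ (symm S m n).left = 𝟙 _ := swap_swap n m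
  rw [e] at h
  exact h

theorem symm_natural {a b c d : ℕ} (x : Cospan S a b) (y : Cospan S c d) :
    Equiv (comp (tensor x y) (symm S b d)) (comp (symm S a c) (tensor y x)) := by
  have h := comp_symm (tensor x y)
  have h' := ofMap_comp (swap S a c) (tensor y x)
  refine Setoid.trans (α := Cospan S (a + c) (d + b)) h
    (Setoid.trans (α := Cospan S (a + c) (d + b)) ?_
      (Setoid.symm (α := Cospan S (a + c) (d + b)) h'))
  refine ⟨⟨sumDesc (sumInr _ _) (sumInl _ _), sumDesc (sumInr _ _) (sumInl _ _), ?_, ?_⟩,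
    ?_, ?_⟩
  · apply sum_hom_ext <;> simp [tensor]
  · apply sum_hom_ext <;> simp [tensor]
  · apply block_hom_ext <;> simp [tensor, swap]
  · apply block_hom_ext <;> simp [tensor, swap]

/-- Renaming of nodes along an equality. -/
def castMap (S : Signature.{u}) {a a' : ℕ} (h : a' = a) : discrete S a' ⟶ discrete S a :=
  ofFun (Fin.cast h)

theorem castMap_rfl (a : ℕ) : castMap S (rfl : a = a) = 𝟙 _ :=
  discrete_hom_ext fun _ => rfl

theorem recast_eq {a a' b b' : ℕ} (ha : a = a') (hb : b = b') (x : Cospan S a b) :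
    recast (Hom := Cospan S) ha hb x =
      ⟨x.apex, castMap S ha.symm ≫ x.left, castMap S hb.symm ≫ x.right⟩ := by
  subst ha hb
  simp only [castMap_rfl, Category.id_comp]
  rfl

theorem castMap_assoc (a b c : ℕ) :
    castMap S (Nat.add_assoc a b c).symm =
      copair (blockL S a b ≫ blockL S (a + b) c)
        (copair (blockR S a b ≫ blockL S (a + b) c) (blockR S (a + b) c)) := by
  apply block_hom_ext
  · simp only [blockL_copair]
    exact discrete_hom_ext fun i => Fin.ext rfl
  · apply block_hom_ext
    · simp only [blockL_copair, blockR_copair]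
      exact discrete_hom_ext fun i => Fin.ext rfl
    · simp only [blockR_copair]
      exact discrete_hom_ext fun i => Fin.ext (Nat.add_assoc a b i).symm

theorem castMap_assoc' (a b c : ℕ) :
    castMap S (Nat.add_assoc a b c) =
      copair (copair (blockL S a (b + c)) (blockL S b c ≫ blockR S a (b + c)))
        (blockR S b c ≫ blockR S a (b + c)) := by
  apply block_hom_ext
  · apply block_hom_ext
    · simp only [blockL_copair]
      exact discrete_hom_ext fun i => Fin.ext rfl
    · simp only [blockL_copair, blockR_copair]
      exact discrete_hom_ext fun i => Fin.ext rfl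
  · simp only [blockR_copair]
    exact discrete_hom_ext fun i => Fin.ext (Nat.add_assoc a b i)

theorem castMap_zero_add (n : ℕ) :
    castMap S (Nat.zero_add n).symm = blockR S 0 n :=
  discrete_hom_ext fun i => Fin.ext (Nat.zero_add i).symm

theorem castMap_add_zero (n : ℕ) :
    castMap S (Nat.add_zero n).symm = blockL S n 0 :=
  discrete_hom_ext fun _ => Fin.ext rfl

theorem tensor_assoc {a b c a' b' c' : ℕ} (x : Cospan S a a') (y : Cospan S b b')
    (z : Cospan S c c') :
    Equiv (recast (Nat.add_assoc a b c) (Nat.add_assoc a' b' c') (tensor (tensor x y) z))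
      (tensor x (tensor y z)) := by
  rw [recast_eq, castMap_assoc, castMap_assoc]
  refine ⟨⟨sumDesc (sumDesc (sumInl _ _) (sumInl _ _ ≫ sumInr _ _)) (sumInr _ _ ≫ sumInr _ _),
    sumDesc (sumInl _ _ ≫ sumInl _ _) (sumDesc (sumInr _ _ ≫ sumInl _ _) (sumInr _ _)),
    ?_, ?_⟩, ?_, ?_⟩
  · apply sum_hom_ext
    · apply sum_hom_ext <;> simp [tensor]
    · simp [tensor]
  · apply sum_hom_ext
    · simp [tensor]
    · apply sum_hom_ext <;> simp [tensor]
  · apply block_hom_ext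
    · simp [tensor]
    · apply block_hom_ext <;> simp [tensor]
  · apply block_hom_ext
    · simp [tensor]
    · apply block_hom_ext <;> simp [tensor]

/-- The empty hypergraph is initial. -/
def ofEmpty (G : Hyp S) : discrete S 0 ⟶ G := ofFun Fin.elim0

theorem empty_hom_ext {G : Hyp S} (f g : discrete S 0 ⟶ G) : f = g :=
  discrete_hom_ext fun i => i.elim0

theorem id_zero_tensor {a b : ℕ} (x : Cospan S a b) :
    Equiv (recast (Nat.zero_add a) (Nat.zero_add b) (tensor (id S 0) x)) x := by
  rw [recast_eq, castMap_zero_add, castMap_zero_add]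
  refine ⟨⟨sumDesc (ofEmpty _) (𝟙 _), sumInr _ _, ?_, ?_⟩, ?_, ?_⟩
  · apply sum_hom_ext
    · exact empty_hom_ext _ _
    · simp [tensor]
  · simp [tensor]
  · simp [tensor]
  · simp [tensor]

theorem tensor_id_zero {a b : ℕ} (x : Cospan S a b) :
    Equiv (recast (Nat.add_zero a) (Nat.add_zero b) (tensor x (id S 0))) x := by
  rw [recast_eq, castMap_add_zero, castMap_add_zero]
  refine ⟨⟨sumDesc (𝟙 _) (ofEmpty _), sumInl _ _, ?_, ?_⟩, ?_, ?_⟩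
  · apply sum_hom_ext
    · simp [tensor]
    · exact empty_hom_ext _ _
  · simp [tensor]
  · simp [tensor]
  · simp [tensor]

theorem recast_ofMap {a a' b b' : ℕ} (ha : a = a') (hb : b = b')
    (f : discrete S a ⟶ discrete S b) :
    recast (Hom := Cospan S) ha hb (ofMap f) = ofMap (castMap S ha.symm ≫ f ≫ castMap S hb) := by
  subst ha hb
  simp only [castMap_rfl, Category.id_comp, Category.comp_id]
  rfl

theorem recast_congr {a a' b b' : ℕ} (ha : a = a') (hb : b = b') {x y : Cospan S a b}
    (h : Equiv x y) : Equiv (recast (Hom := Cospan S) ha hb x) (recast ha hb y) := by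
  subst ha hb; exact h

theorem ofMap_comp_ofMap {a b c : ℕ} (f : discrete S a ⟶ discrete S b)
    (g : discrete S b ⟶ discrete S c) : Equiv (comp (ofMap f) (ofMap g)) (ofMap (f ≫ g)) :=
  ofMap_comp f (ofMap g)

theorem hexagon (a b c : ℕ) :
    Equiv (recast (Nat.add_assoc a b c).symm rfl (symm S a (b + c)))
      (comp (tensor (symm S a b) (id S c))
        (recast (Nat.add_assoc b a c).symm (Nat.add_assoc b c a).symm
          (tensor (id S b) (symm S a c)))) := by
  have h₁ := tensor_ofMap (swap S a b) (𝟙 (discrete S c))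
  have h₂ := recast_congr (Nat.add_assoc b a c).symm (Nat.add_assoc b c a).symm
    (tensor_ofMap (𝟙 (discrete S b)) (swap S a c))
  rw [recast_ofMap] at h₂
  have h₃ := comp_congr h₁ h₂
  have h₄ := ofMap_comp_ofMap
    (copair (swap S a b ≫ blockL S (b + a) c) (𝟙 _ ≫ blockR S (b + a) c))
    (castMap S (Nat.add_assoc b a c).symm.symm ≫
      copair (𝟙 _ ≫ blockL S b (c + a)) (swap S a c ≫ blockR S b (c + a)) ≫
      castMap S (Nat.add_assoc b c a).symm)
  refine Setoid.symm (α := Cospan S (a + b + c) (b + c + a))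
    (Setoid.trans (α := Cospan S (a + b + c) (b + c + a)) h₃
      (Setoid.trans (α := Cospan S (a + b + c) (b + c + a)) h₄ ?_))
  have e : recast (Hom := Cospan S) (Nat.add_assoc a b c).symm rfl (symm S a (b + c)) =
      ofMap (castMap S (Nat.add_assoc a b c) ≫ swap S a (b + c)) :=
    (recast_ofMap (Nat.add_assoc a b c).symm rfl (swap S a (b + c))).trans
      (by rw [castMap_rfl, Category.comp_id])
  rw [e, castMap_assoc', castMap_assoc, castMap_assoc']
  refine Eq.subst (motive := fun f => Equiv (ofMap _) (ofMap f)) ?_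
    (Setoid.refl (α := Cospan S (a + b + c) (b + c + a)) _)
  apply block_hom_ext
  · apply block_hom_ext <;> simp [swap]
  · simp [swap]

end Cospan

/-- Arrows of `FTerm_Σ`: cospans of hypergraphs with discrete feet, up to isomorphism. -/
def FTermHom (S : Signature.{u}) (n m : ℕ) : Type (max 1 u) := Quotient (Cospan.setoid S n m)

/-- The isomorphism class of a cospan. -/
def FTermHom.mk {S : Signature.{u}} {n m : ℕ} (x : Cospan S n m) : FTermHom S n m :=
  Quotient.mk (Cospan.setoid S n m) x

theorem FTermHom.sound {S : Signature.{u}} {n m : ℕ} {x y : Cospan S n m}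
    (h : Cospan.Equiv x y) : FTermHom.mk x = FTermHom.mk y :=
  Quotient.sound h

theorem FTermHom.recast_mk {S : Signature.{u}} {a a' b b' : ℕ} (ha : a = a') (hb : b = b')
    (x : Cospan S a b) :
    recast (Hom := FTermHom S) ha hb (FTermHom.mk x) = FTermHom.mk (recast ha hb x) := by
  subst ha hb; rfl

/-- The PROP `FTerm_Σ` of `Σ`-Frobenius termgraphs. -/
def fterm (S : Signature.{u}) : PROP.{max 1 u} where
  Hom := FTermHom S
  id n := FTermHom.mk (Cospan.id S n)
  comp := Quotient.map₂ Cospan.comp (fun _ _ h _ _ h' => Cospan.comp_congr h h')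
  tensor := Quotient.map₂ Cospan.tensor (fun _ _ h _ _ h' => Cospan.tensor_congr h h')
  symm n m := FTermHom.mk (Cospan.symm S n m)
  id_comp := by
    rintro a b ⟨f⟩; exact FTermHom.sound (Cospan.id_comp f)
  comp_id := by
    rintro a b ⟨f⟩; exact FTermHom.sound (Cospan.comp_id f)
  assoc := by
    rintro a b c d ⟨f⟩ ⟨g⟩ ⟨h⟩; exact FTermHom.sound (Cospan.assoc f g h)
  tensor_id n m := FTermHom.sound (Cospan.tensor_id n m)
  interchange := by
    rintro a b c a' b' c' ⟨f⟩ ⟨g⟩ ⟨f'⟩ ⟨g'⟩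
    exact FTermHom.sound (Cospan.interchange f g f' g')
  tensor_assoc := by
    rintro a b c a' b' c' ⟨f⟩ ⟨g⟩ ⟨h⟩
    exact (FTermHom.recast_mk _ _ _).trans (FTermHom.sound (Cospan.tensor_assoc f g h))
  id_zero_tensor := by
    rintro a b ⟨f⟩
    exact (FTermHom.recast_mk _ _ _).trans (FTermHom.sound (Cospan.id_zero_tensor f))
  tensor_id_zero := by
    rintro a b ⟨f⟩
    exact (FTermHom.recast_mk _ _ _).trans (FTermHom.sound (Cospan.tensor_id_zero f))
  symm_symm n m := FTermHom.sound (Cospan.symm_symm n m)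
  symm_natural := by
    rintro a b c d ⟨f⟩ ⟨g⟩; exact FTermHom.sound (Cospan.symm_natural f g)
  hexagon a b c := by
    rw [FTermHom.recast_mk]
    refine (FTermHom.sound (Cospan.hexagon a b c)).trans ?_
    exact (congrArg (Quotient.map₂ Cospan.comp (fun _ _ h _ _ h' => Cospan.comp_congr h h')
      (FTermHom.mk (Cospan.tensor (Cospan.symm S a b) (Cospan.id S c))))
      (FTermHom.recast_mk _ _ _)).symm

/-- The PROP morphism `⟦·⟧ : S_Σ ⟶ FTerm_Σ` that sends each generator to its single-hyperedge
cospan. -/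
def interp (S : Signature.{u}) : PROP.Morphism (freeProp S) (fterm S) :=
  freeLift (fterm S) fun o => FTermHom.mk (Cospan.gen o)

theorem interp_gen {S : Signature.{u}} (o : S.Gen) :
    (interp S).map (freeGen o) = FTermHom.mk (Cospan.gen o) := rfl

end StringDiagram

/-! A string diagram can be rebuilt from its hypergraph up to the laws of symmetric strict monoidal
categories. The link is the relation `Realizes G f l E l'`: the wires of the arrow `f` are labelled
by nodes of a fixed hypergraph `G` and its boxes by hyperedges of `G`, with input wires `l`, boxes
`E` and output wires `l'`. Every term is realized in its own cospan, between the nodes of the two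
legs, with each hyperedge used exactly once (`Term.exists_realizes`), and realizations are carried
along hypergraph morphisms (`Realizes.map`). Terms with isomorphic cospans thus have realizations in
one hypergraph with the same `l`, `E`, `l'`, and what remains is that such data determine the arrow
(`Realizes.eq_of_fresh`).

This holds when no node is produced twice by the inputs and the boxes (`Hyp.Fresh`). Freshness and
the balance of produced and consumed nodes (`Realizes.conservation`) show that a node which is both
input and output lies on a bare wire, which can be split off (`Realizes.exists_wire`). The proof is
then an induction on the number of boxes. An arrow without boxes permutes distinct wires, so it is
determined by peeling them off one at a time (`Realizes.eq_of_noEdges`). If there are boxes, one of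
them has all its sources among the inputs (`Realizes.exists_first_box`), a condition that does not
mention the arrow; hence the same box can be moved to the front of both arrows
(`Realizes.exists_box`). The remainders agree up to a permutation of wires, which slides past the
box by interchange.

All equations are between bundled arrows `PROP.Arr`, where strict associativity and units are plain
equalities and the monoidal product is a monoid. -/

namespace StringDiagram

/-! ## The strict calculus of arrows of a PROP -/

/-- The arrows of a PROP with their domain and codomain bundled. Equality of bundled arrows
absorbs all transports along equalities of natural numbers. -/
structure PROP.Arr (X : PROP.{v}) where
  dom : ℕ
  cod : ℕ
  hom : X.Hom dom cod

namespace PROP.Arr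

variable {X : PROP.{v}}

theorem mk_recast {a a' b b' : ℕ} (ha : a = a') (hb : b = b') (f : X.Hom a b) :
    (⟨a', b', recast ha hb f⟩ : Arr X) = ⟨a, b, f⟩ := by
  subst ha hb; rfl

/-- The identity arrow. -/
def one (X : PROP.{v}) (n : ℕ) : Arr X := ⟨n, n, X.id n⟩

/-- The symmetry. -/
def swap (X : PROP.{v}) (n m : ℕ) : Arr X := ⟨n + m, m + n, X.symm n m⟩

/-- Bundled arrows form a monoid under the monoidal product. -/
instance : Monoid (Arr X) where
  mul f g := ⟨f.dom + g.dom, f.cod + g.cod, X.tensor f.hom g.hom⟩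
  one := one X 0
  mul_assoc f g h := by
    refine (mk_recast (Nat.add_assoc _ _ _) (Nat.add_assoc _ _ _) _).symm.trans ?_
    exact congrArg (Arr.mk _ _) (X.tensor_assoc f.hom g.hom h.hom)
  one_mul f := by
    refine (mk_recast (Nat.zero_add _) (Nat.zero_add _) _).symm.trans ?_
    exact congrArg (Arr.mk _ _) (X.id_zero_tensor f.hom)
  mul_one f := by
    refine (mk_recast (Nat.add_zero _) (Nat.add_zero _) _).symm.trans ?_
    exact congrArg (Arr.mk _ _) (X.tensor_id_zero f.hom)

/-- Composition of bundled arrows, with the value `f` if the arrows are not composable. -/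
def comp (f g : Arr X) : Arr X :=
  if h : f.cod = g.dom then ⟨f.dom, g.cod, X.comp f.hom (recast h.symm rfl g.hom)⟩ else f

infixl:65 " ⬝ " => PROP.Arr.comp

theorem mk_comp_mk {a b c : ℕ} (f : X.Hom a b) (g : X.Hom b c) :
    (⟨a, b, f⟩ : Arr X) ⬝ ⟨b, c, g⟩ = ⟨a, c, X.comp f g⟩ := by
  simp [comp, recast]

theorem mk_mul_mk {a b c d : ℕ} (f : X.Hom a b) (g : X.Hom c d) :
    (⟨a, b, f⟩ : Arr X) * ⟨c, d, g⟩ = ⟨a + c, b + d, X.tensor f g⟩ := rfl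

@[simp] theorem one_dom (n : ℕ) : (one X n).dom = n := rfl
@[simp] theorem one_cod (n : ℕ) : (one X n).cod = n := rfl
@[simp] theorem swap_dom (n m : ℕ) : (swap X n m).dom = n + m := rfl
@[simp] theorem swap_cod (n m : ℕ) : (swap X n m).cod = m + n := rfl
@[simp] theorem mul_dom (f g : Arr X) : (f * g).dom = f.dom + g.dom := rfl
@[simp] theorem mul_cod (f g : Arr X) : (f * g).cod = f.cod + g.cod := rfl

-- The default value `f` of a non-composable pair makes this unconditional; `comp_cod` does need
-- composability.
@[simp] theorem comp_dom (f g : Arr X) : (f ⬝ g).dom = f.dom := by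
  unfold comp; split_ifs <;> rfl

theorem comp_cod {f g : Arr X} (h : f.cod = g.dom) : (f ⬝ g).cod = g.cod := by
  simp [comp, h]

theorem one_zero : one X 0 = 1 := rfl

theorem one_mul_one (n m : ℕ) : one X n * one X m = one X (n + m) :=
  congrArg (Arr.mk _ _) (X.tensor_id n m)

theorem one_comp (f : Arr X) {n : ℕ} (h : f.dom = n) : one X n ⬝ f = f := by
  subst h
  exact (mk_comp_mk _ _).trans (congrArg (Arr.mk _ _) (X.id_comp _))

theorem comp_one (f : Arr X) {n : ℕ} (h : f.cod = n) : f ⬝ one X n = f := by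
  subst h
  exact (mk_comp_mk _ _).trans (congrArg (Arr.mk _ _) (X.comp_id _))

theorem one_comp_one (n : ℕ) : one X n ⬝ one X n = one X n := one_comp _ rfl

theorem comp_assoc {f g h : Arr X} (hfg : f.cod = g.dom) (hgh : g.cod = h.dom) :
    f ⬝ g ⬝ h = f ⬝ (g ⬝ h) := by
  obtain ⟨a, b, f⟩ := f
  obtain ⟨b', c, g⟩ := g
  obtain ⟨c', d, h⟩ := h
  obtain rfl : b = b' := hfg
  obtain rfl : c = c' := hgh
  simp only [mk_comp_mk, X.assoc]

theorem mul_comp_mul {f g f' g' : Arr X} (h : f.cod = g.dom) (h' : f'.cod = g'.dom) :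
    (f * f') ⬝ (g * g') = (f ⬝ g) * (f' ⬝ g') := by
  obtain ⟨a, b, f⟩ := f
  obtain ⟨b', c, g⟩ := g
  obtain ⟨d, e, f'⟩ := f'
  obtain ⟨e', k, g'⟩ := g'
  obtain rfl : b = b' := h
  obtain rfl : e = e' := h'
  simp only [mk_comp_mk, mk_mul_mk, X.interchange]

theorem swap_comp_swap (n m : ℕ) : swap X n m ⬝ swap X m n = one X (n + m) :=
  (mk_comp_mk _ _).trans (congrArg (Arr.mk _ _) (X.symm_symm n m))

theorem mul_comp_swap (f g : Arr X) :
    (f * g) ⬝ swap X f.cod g.cod = swap X f.dom g.dom ⬝ (g * f) :=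
  (mk_comp_mk _ _).trans ((congrArg (Arr.mk _ _) (X.symm_natural f.hom g.hom)).trans
    (mk_comp_mk _ _).symm)

theorem swap_add_right (a b c : ℕ) :
    swap X a (b + c) = (swap X a b * one X c) ⬝ (one X b * swap X a c) := by
  have h := (mk_recast (Nat.add_assoc a b c).symm rfl (X.symm a (b + c))).symm.trans
    (congrArg (Arr.mk _ _) (X.hexagon a b c))
  refine h.trans ((mk_comp_mk _ _).symm.trans (congrArg (_ ⬝ ·) ?_))
  exact mk_recast _ _ _

/-- Splitting a composite along a tensor factor on the left. -/
theorem mul_comp_left (f g : Arr X) {n : ℕ} (h : f.cod = g.dom) :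
    (f ⬝ g) * one X n = (f * one X n) ⬝ (g * one X n) := by
  rw [mul_comp_mul h rfl, one_comp_one]

theorem mul_comp_right (f g : Arr X) {n : ℕ} (h : f.cod = g.dom) :
    one X n * (f ⬝ g) = (one X n * f) ⬝ (one X n * g) := by
  rw [mul_comp_mul rfl h, one_comp_one]

theorem mul_eq_left_comp (f g : Arr X) : f * g = (f * one X g.dom) ⬝ (one X f.cod * g) := by
  rw [mul_comp_mul rfl rfl, one_comp _ rfl, comp_one _ rfl]

theorem mul_eq_right_comp (f g : Arr X) : f * g = (one X f.dom * g) ⬝ (f * one X g.cod) := by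
  rw [mul_comp_mul rfl rfl, one_comp _ rfl, comp_one _ rfl]

/-- Only one hexagon is an axiom. This one follows because both sides are inverse to `swap X c (a +
b)`. -/
theorem swap_add_left (a b c : ℕ) :
    swap X (a + b) c = (one X a * swap X b c) ⬝ (swap X a c * one X b) := by
  have h₁ : ((one X a * swap X b c) ⬝ (swap X a c * one X b)) ⬝ swap X c (a + b) =
      one X (a + b + c) := by
    rw [swap_add_right, comp_assoc (by simp; omega) (by rw [comp_dom]; simp),
      ← comp_assoc (f := swap X a c * one X b) (by simp) (by simp; omega),
      mul_comp_mul (by simp) (by simp), swap_comp_swap, one_comp_one, ← one_mul_one, mul_assoc,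
      mul_comp_mul rfl (by simp), one_comp_one, one_mul_one, one_comp _ (by simp),
      mul_comp_mul rfl (by simp), swap_comp_swap, one_comp_one, one_mul_one, Nat.add_assoc]
  have h₂ : ∀ f : Arr X, f.cod = c + (a + b) → f ⬝ swap X c (a + b) = one X (a + b + c) →
      f = swap X (a + b) c := by
    intro f hf h
    have hd : f.dom = a + b + c := by simpa using congrArg Arr.dom h
    rw [← comp_one f hf, ← swap_comp_swap c (a + b), ← comp_assoc (by simp [hf]) (by simp), h,
      one_comp _ (by simp)]
  exact (h₂ _ (by rw [comp_cod (by simp; omega)]; simp; omega) h₁).symm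

/-- The hexagon at `0 = 0 + 0` makes this symmetry idempotent, and an invertible idempotent is an
identity. -/
theorem swap_zero_right (a : ℕ) : swap X a 0 = one X a := by
  have h : swap X a 0 = swap X a 0 ⬝ swap X a 0 := by
    conv_lhs => rw [show (0 : ℕ) = 0 + 0 from rfl, swap_add_right, one_zero, mul_one, one_mul]
  calc swap X a 0 = swap X a 0 ⬝ (swap X a 0 ⬝ swap X 0 a) := by
        rw [swap_comp_swap, comp_one _ (by simp)]
    _ = one X a := by
        rw [← comp_assoc (by simp) (by simp), ← h, swap_comp_swap, Nat.add_zero]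

theorem swap_zero_left (a : ℕ) : swap X 0 a = one X a := by
  have h := swap_comp_swap (X := X) 0 a
  rwa [swap_zero_right, comp_one _ (by simp), Nat.zero_add] at h

/-! ### Moving a single wire to the front. -/

/-- Moving the wire in position `n` to the front, past `n` wires, with `m` wires behind it. -/
def pull (X : PROP.{v}) (n m : ℕ) : Arr X := swap X n 1 * one X m

@[simp] theorem pull_dom (n m : ℕ) : (pull X n m).dom = n + 1 + m := rfl
@[simp] theorem pull_cod (n m : ℕ) : (pull X n m).cod = 1 + n + m := rfl

theorem pull_zero (m : ℕ) : pull X 0 m = one X (1 + m) := by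
  rw [pull, swap_zero_left, one_mul_one]

theorem pull_mul_one (n m k : ℕ) : pull X n m * one X k = pull X n (m + k) := by
  rw [pull, pull, mul_assoc, one_mul_one]

theorem pull_add (k n m : ℕ) :
    pull X (k + n) m = (one X k * pull X n m) ⬝ (swap X k 1 * one X (n + m)) := by
  rw [pull, pull, swap_add_left, mul_comp_left _ _ (by simp; omega), mul_assoc, mul_assoc,
    one_mul_one]

/-- The hypothesis `h` says that one wire crosses `f` untouched, from position `n` to position `n'`,
leaving `f'`. This and the next lemma are the monoidal product cases of `Realizes.exists_wire`. Here
`g` lies behind the wire and merely enlarges the block behind it. -/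
theorem mul_comp_pull_left {f f' g : Arr X} {n m n' m' : ℕ}
    (h : f ⬝ pull X n' m' = pull X n m ⬝ (one X 1 * f')) (hd : f.cod = n' + 1 + m')
    (hf' : f'.dom = n + m) :
    (f * g) ⬝ pull X n' (m' + g.cod) = pull X n (m + g.dom) ⬝ (one X 1 * (f' * g)) := by
  rw [← pull_mul_one, ← pull_mul_one, mul_comp_mul (by simp [hd]) (by simp), h, comp_one _ rfl,
    ← mul_assoc, mul_comp_mul (by simp [hf']; omega) (by simp), one_comp _ rfl]

/-- Here `f` lies in front of the wire, which crosses it by naturality of the symmetry. -/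
theorem mul_comp_pull_right {f g g' : Arr X} {n m n' m' : ℕ}
    (h : g ⬝ pull X n' m' = pull X n m ⬝ (one X 1 * g')) (hd : g.cod = n' + 1 + m')
    (hg' : g'.dom = n + m) (hc : g'.cod = n' + m') :
    (f * g) ⬝ pull X (f.cod + n') m' = pull X (f.dom + n) m ⬝ (one X 1 * (f * g')) := by
  have h' := mul_comp_swap f (one X 1)
  rw [one_cod, one_dom] at h'
  have hf : f * (pull X n m ⬝ (one X 1 * g')) =
      (one X f.dom * pull X n m) ⬝ (f * one X 1 * g') := by
    rw [mul_assoc, mul_comp_mul rfl (by simp [hg']; omega), one_comp _ rfl]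
  rw [pull_add, pull_add, ← comp_assoc (by simp [hd]) (by simp; omega),
    mul_comp_mul rfl (by simp [hd]), h, comp_one _ rfl, hf,
    comp_assoc (by simp [hg']; omega) (by simp [hc]), mul_comp_mul (by simp) (by simp [hc]),
    comp_one _ hc, h', comp_assoc (by simp; omega) (by simp [hg']; omega), ← mul_assoc (one X 1),
    mul_comp_mul (f := swap X f.dom 1) (by simp) (by simp [hg']), one_comp _ hg']

/-- Naturality of the symmetry moves `pull` across it; the crossing of the single wire with the `k`
others then cancels against its inverse. -/
theorem swap_comp_pull_left (n m k : ℕ) :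
    swap X (n + 1 + m) k ⬝ pull X (k + n) m =
      pull X n (m + k) ⬝ (one X 1 * swap X (n + m) k) := by
  have h := mul_comp_swap (pull X n m) (one X k)
  simp only [one_cod, one_dom, pull_dom, pull_cod] at h
  rw [pull_add, ← comp_assoc (by simp) (by simp; omega), ← h, pull_mul_one, Nat.add_assoc 1 n m,
    swap_add_left, comp_assoc (by simp; omega) (by rw [comp_cod (by simp; omega)]; simp),
    comp_assoc (by simp; omega) (by simp), mul_comp_mul (by simp) rfl, swap_comp_swap,
    one_comp_one, one_mul_one, comp_one _ (by simp; omega)]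

theorem swap_comp_pull_right (n m k : ℕ) :
    swap X k (n + 1 + m) ⬝ pull X n (m + k) =
      pull X (k + n) m ⬝ (one X 1 * swap X k (n + m)) := by
  have h := mul_comp_swap (one X k) (pull X n m)
  simp only [one_cod, one_dom, pull_dom, pull_cod] at h
  rw [← pull_mul_one, ← h, pull_add, Nat.add_assoc 1 n m, swap_add_right,
    comp_assoc (by simp; omega) (by simp; omega)]

end PROP.Arr
/-! ## Realizations of arrows of the free PROP in a hypergraph -/

open PROP PROP.Arr

variable {S : Signature.{u}}

/-- `Realizes G f l E l'` says that `f`, read as a string diagram, can be traced in `G` with its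
input wires on the nodes `l`, its boxes on the hyperedges `E` and its output wires on the
nodes `l'`. -/
inductive Realizes (G : Hyp S) :
    Arr (freeProp S) → List G.Node → Multiset G.Edge → List G.Node → Prop
  | gen (e : G.Edge) : Realizes G ⟨_, _, freeGen (G.label e)⟩ (G.src e) {e} (G.tgt e)
  | one (l : List G.Node) : Realizes G (Arr.one _ l.length) l 0 l
  | swap (l l' : List G.Node) :
      Realizes G (Arr.swap _ l.length l'.length) (l ++ l') 0 (l' ++ l)
  | comp {f g : Arr (freeProp S)} {l m l' : List G.Node} {E E' : Multiset G.Edge}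
      (hf : Realizes G f l E m) (hg : Realizes G g m E' l') : Realizes G (f ⬝ g) l (E + E') l'
  | mul {f g : Arr (freeProp S)} {l m l' m' : List G.Node} {E E' : Multiset G.Edge}
      (hf : Realizes G f l E l') (hg : Realizes G g m E' m') :
      Realizes G (f * g) (l ++ m) (E + E') (l' ++ m')

/-! ### The balance of produced and consumed nodes. -/

/-- The source nodes of a multiset of hyperedges. -/
def Hyp.sources (G : Hyp S) (E : Multiset G.Edge) : Multiset G.Node :=
  E.bind fun e => ↑(G.src e)

/-- The target nodes of a multiset of hyperedges. -/
def Hyp.targets (G : Hyp S) (E : Multiset G.Edge) : Multiset G.Node :=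
  E.bind fun e => ↑(G.tgt e)

@[simp] theorem Hyp.sources_zero (G : Hyp S) : G.sources 0 = 0 := rfl
@[simp] theorem Hyp.targets_zero (G : Hyp S) : G.targets 0 = 0 := rfl

@[simp] theorem Hyp.sources_add (G : Hyp S) (E E' : Multiset G.Edge) :
    G.sources (E + E') = G.sources E + G.sources E' := Multiset.add_bind ..

@[simp] theorem Hyp.targets_add (G : Hyp S) (E E' : Multiset G.Edge) :
    G.targets (E + E') = G.targets E + G.targets E' := Multiset.add_bind ..

@[simp] theorem Hyp.targets_cons (G : Hyp S) (e : G.Edge) (E : Multiset G.Edge) :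
    G.targets (e ::ₘ E) = ↑(G.tgt e) + G.targets E := Multiset.cons_bind ..

@[simp] theorem Hyp.sources_singleton (G : Hyp S) (e : G.Edge) :
    G.sources {e} = ↑(G.src e) := Multiset.singleton_bind ..

@[simp] theorem Hyp.targets_singleton (G : Hyp S) (e : G.Edge) :
    G.targets {e} = ↑(G.tgt e) := Multiset.singleton_bind ..

theorem Hyp.mem_sources {G : Hyp S} {E : Multiset G.Edge} {e : G.Edge} (he : e ∈ E) {x : G.Node}
    (hx : x ∈ G.src e) : x ∈ G.sources E :=
  Multiset.mem_bind.2 ⟨e, he, by simpa using hx⟩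

namespace Realizes

variable {G : Hyp S} {f g : Arr (freeProp S)} {l l' : List G.Node} {E : Multiset G.Edge}

/-- The list shared by the two premises of the rule `comp` forces composability, so the default
value of `⬝` never occurs in a realization. -/
theorem dom_cod (h : Realizes G f l E l') : f.dom = l.length ∧ f.cod = l'.length := by
  induction h with
  | gen e => exact ⟨(G.length_src e).symm, (G.length_tgt e).symm⟩
  | one l => simp
  | swap l l' => simp
  | comp _ _ ihf ihg =>
    exact ⟨by rw [comp_dom, ihf.1], by rw [comp_cod (ihf.2.trans ihg.1.symm), ihg.2]⟩
  | mul _ _ ihf ihg => simp [ihf, ihg]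

theorem dom (h : Realizes G f l E l') : f.dom = l.length := h.dom_cod.1

theorem cod (h : Realizes G f l E l') : f.cod = l'.length := h.dom_cod.2

/-- Every node that is consumed has been produced, with multiplicity. -/
theorem conservation (h : Realizes G f l E l') :
    (l : Multiset G.Node) + G.targets E = l' + G.sources E := by
  induction h with
  | gen e => simp [add_comm]
  | one l => rfl
  | swap l l' => simp [← Multiset.coe_add, add_comm]
  | @comp f g l m l' E E' _ _ ihf ihg =>
    rw [Hyp.targets_add, ← add_assoc, ihf, add_right_comm, ihg, Hyp.sources_add, add_assoc,
      add_comm (G.sources E')]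
  | mul _ _ ihf ihg =>
    rw [Hyp.targets_add, Hyp.sources_add, ← Multiset.coe_add, ← Multiset.coe_add,
      add_add_add_comm, ihf, ihg, add_add_add_comm]

theorem perm (h : Realizes G f l 0 l') : l.Perm l' := by
  simpa using h.conservation

end Realizes

/-! ### Freshness and its inheritance by subdiagrams. -/

/-- No node is produced twice by the input nodes `l` and the hyperedges `E`. -/
def Hyp.Fresh (G : Hyp S) (l : List G.Node) (E : Multiset G.Edge) : Prop :=
  ((l : Multiset G.Node) + G.targets E).Nodup

namespace Hyp.Fresh

variable {G : Hyp S} {f : Arr (freeProp S)} {l l' l₁ l₂ : List G.Node}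
  {E E₁ E₂ : Multiset G.Edge}

theorem of_le (h : G.Fresh l E)
    (hle : (l' : Multiset G.Node) + G.targets E₁ ≤ l + G.targets E) : G.Fresh l' E₁ :=
  Multiset.nodup_of_le hle h

theorem nodup (h : G.Fresh l E) : l.Nodup :=
  Multiset.coe_nodup.1 (Multiset.nodup_of_le (Multiset.le_add_right _ _) h)

theorem disjoint (h : G.Fresh l E) {x : G.Node} (hx : x ∈ l) : x ∉ G.targets E :=
  fun hx' => Multiset.disjoint_left.1 (Multiset.nodup_add.1 h).2.2 (Multiset.mem_coe.2 hx) hx'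

theorem left (h : G.Fresh l (E₁ + E₂)) : G.Fresh l E₁ :=
  h.of_le (by rw [Hyp.targets_add, ← add_assoc]; exact Multiset.le_add_right _ _)

/-- By conservation, the outputs of the first factor are among the nodes produced by `l` and `E₁`.
-/
theorem right (h : G.Fresh l (E₁ + E₂)) (hf : Realizes G f l E₁ l') : G.Fresh l' E₂ :=
  h.of_le (by
    rw [Hyp.targets_add, ← add_assoc, hf.conservation, add_right_comm]
    exact Multiset.le_add_right _ _)

theorem nodup_cod (h : G.Fresh l E) (hf : Realizes G f l E l') : l'.Nodup :=
  (right (E₂ := 0) (by simpa using h) hf).nodup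

theorem append_left (h : G.Fresh (l₁ ++ l₂) (E₁ + E₂)) : G.Fresh l₁ E₁ :=
  h.of_le (by
    rw [Hyp.targets_add, ← Multiset.coe_add, add_add_add_comm]; exact Multiset.le_add_right _ _)

theorem append_right (h : G.Fresh (l₁ ++ l₂) (E₁ + E₂)) : G.Fresh l₂ E₂ :=
  h.of_le (by
    rw [Hyp.targets_add, ← Multiset.coe_add, add_add_add_comm]; exact Multiset.le_add_left _ _)

theorem append_disjoint (h : G.Fresh (l₁ ++ l₂) (E₁ + E₂)) {x : G.Node}
    (h₁ : x ∈ (l₁ : Multiset G.Node) + G.targets E₁)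
    (h₂ : x ∈ (l₂ : Multiset G.Node) + G.targets E₂) : False := by
  have h' : ((l₁ : Multiset G.Node) + G.targets E₁ + (l₂ + G.targets E₂)).Nodup := by
    rw [← add_add_add_comm, Multiset.coe_add, ← Hyp.targets_add]; exact h
  exact Multiset.disjoint_left.1 (Multiset.nodup_add.1 h').2.2 h₁ h₂

end Hyp.Fresh

/-! ### Splitting off wires without boxes. -/

namespace Realizes

variable {G : Hyp S} {f g : Arr (freeProp S)} {l l' : List G.Node} {E : Multiset G.Edge}

theorem of_eq_length {n : ℕ} (h : n = l.length) : Realizes G (Arr.one _ n) l 0 l :=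
  h ▸ .one l

theorem pull (p q : List G.Node) (x : G.Node) :
    Realizes G (Arr.pull _ p.length q.length) (p ++ x :: q) 0 (x :: (p ++ q)) := by
  have h := Realizes.mul (.swap p [x]) (.one q)
  simp only [List.append_assoc, List.singleton_append] at h
  exact h

theorem cons {E : Multiset G.Edge} (x : G.Node) (h : Realizes G f l E l') :
    Realizes G (Arr.one _ 1 * f) (x :: l) E (x :: l') := by
  have h := Realizes.mul (.one [x]) h
  rw [zero_add] at h
  exact h

theorem one_mul {E : Multiset G.Edge} (m : List G.Node) (h : Realizes G f l E l') :
    Realizes G (Arr.one _ m.length * f) (m ++ l) E (m ++ l') := by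
  have h := Realizes.mul (.one m) h
  rwa [zero_add] at h

theorem mul_one {E : Multiset G.Edge} (m : List G.Node) (h : Realizes G f l E l') :
    Realizes G (f * Arr.one _ m.length) (l ++ m) E (l' ++ m) := by
  have h := Realizes.mul h (.one m)
  rwa [add_zero] at h

theorem zero_comp {m : List G.Node} (hf : Realizes G f l 0 m) (hg : Realizes G g m E l') :
    Realizes G (f ⬝ g) l E l' := by
  have h := hf.comp hg
  rwa [zero_add] at h

theorem comp_zero {m : List G.Node} (hf : Realizes G f l E m) (hg : Realizes G g m 0 l') :
    Realizes G (f ⬝ g) l E l' := by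
  have h := hf.comp hg
  rwa [add_zero] at h

theorem _root_.List.append_cons_inj_of_nodup {α : Type*} {x : α} {p q p' q' : List α}
    (h : p ++ x :: q = p' ++ x :: q') (hn : (p ++ x :: q).Nodup) : p = p' ∧ q = q' := by
  induction p generalizing p' with
  | nil =>
    cases p' with
    | nil => simpa using h
    | cons y p' =>
      simp only [List.nil_append, List.cons_append, List.cons.injEq] at h
      obtain ⟨rfl, rfl⟩ := h
      simp at hn
  | cons y p ih =>
    cases p' with
    | nil =>
      simp only [List.nil_append, List.cons_append, List.cons.injEq] at h
      obtain ⟨rfl, rfl⟩ := h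
      simp at hn
    | cons z p' =>
      simp only [List.cons_append, List.cons.injEq] at h
      obtain ⟨rfl, h⟩ := h
      obtain ⟨rfl, rfl⟩ := ih h (List.nodup_cons.1 hn).2
      simp

/-- The position of an occurrence of `x` in a concatenation. -/
theorem _root_.List.append_eq_append_cons {α : Type*} {x : α} {l m p q : List α}
    (h : l ++ m = p ++ x :: q) :
    (∃ q₁, l = p ++ x :: q₁ ∧ q = q₁ ++ m) ∨ ∃ p₂, m = p₂ ++ x :: q ∧ p = l ++ p₂ := by
  rcases List.append_eq_append_iff.1 h with ⟨a, ha, h⟩ | ⟨a, ha, h⟩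
  · exact .inr ⟨a, h, ha⟩
  · cases a with
    | nil => exact .inr ⟨[], h.symm, by simpa using ha.symm⟩
    | cons y a =>
      simp only [List.cons_append, List.cons.injEq] at h
      obtain ⟨rfl, rfl⟩ := h
      exact .inl ⟨a, ha, rfl⟩

/-- A node that is both an input and an output is carried by a wire without boxes, which can be
split off. -/
theorem exists_wire (h : Realizes G f l E l') (hG : G.Fresh l E) {p q p' q' : List G.Node}
    {x : G.Node} (hl : l = p ++ x :: q) (hl' : l' = p' ++ x :: q') :
    ∃ f', Realizes G f' (p ++ q) E (p' ++ q') ∧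
      f ⬝ Arr.pull _ p'.length q'.length =
        Arr.pull _ p.length q.length ⬝ (Arr.one _ 1 * f') := by
  induction h generalizing p q p' q' with
  | gen e =>
    -- By freshness a box shares no node between its sources and its targets.
    refine (hG.disjoint (x := x) (by simp [hl]) ?_).elim
    simp [hl']
  | one l =>
    obtain ⟨rfl, rfl⟩ := List.append_cons_inj_of_nodup (hl.symm.trans hl') (hl ▸ hG.nodup)
    refine ⟨_, .one (p ++ q), ?_⟩
    rw [one_comp _ (by simp [hl]; omega), one_mul_one, comp_one _ (by simp; omega)]
  | swap l m =>
    rcases List.append_eq_append_cons hl with ⟨q₁, rfl, rfl⟩ | ⟨p₂, rfl, rfl⟩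
    · rw [← List.append_assoc] at hl'
      obtain ⟨rfl, rfl⟩ := List.append_cons_inj_of_nodup hl' (by
        have := hG.nodup
        rw [List.nodup_append_comm] at this
        rwa [List.append_assoc])
      refine ⟨_, by simpa using Realizes.swap (p ++ q₁) m, ?_⟩
      have := swap_comp_pull_left (X := freeProp S) p.length q₁.length m.length
      simpa [Nat.add_assoc, Nat.add_comm, Nat.add_left_comm] using this
    · rw [List.append_assoc, List.cons_append] at hl'
      obtain ⟨rfl, rfl⟩ := List.append_cons_inj_of_nodup hl' (by
        have := hG.nodup
        rw [List.nodup_append_comm] at this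
        simpa using this)
      refine ⟨_, by simpa using Realizes.swap l (p₂ ++ q), ?_⟩
      have := swap_comp_pull_right (X := freeProp S) p₂.length q.length l.length
      simpa [Nat.add_assoc, Nat.add_comm, Nat.add_left_comm] using this
  | @comp f g l m l' E₁ E₂ hf hg ihf ihg =>
    -- The wire passes through the middle: conservation for `g` leaves only `m` or the targets of
    -- `E₂` as origin of `x`, and freshness excludes the targets since `x` is already an input.
    have hx : x ∈ m := by
      have h₁ : x ∈ (m : Multiset G.Node) + G.targets E₂ := by
        rw [hg.conservation]; simp [hl']
      rcases Multiset.mem_add.1 h₁ with h₁ | h₁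
      · simpa using h₁
      · refine (hG.disjoint (x := x) (by simp [hl]) ?_).elim
        simp [h₁]
    obtain ⟨r, s, hm⟩ := List.append_of_mem hx
    obtain ⟨f', hf', ef⟩ := ihf hG.left hl hm
    obtain ⟨g', hg', eg⟩ := ihg (hG.right hf) hm hl'
    have d₁ := hf.cod; have d₂ := hg.dom; have d₃ := hg.cod
    have d₄ := hf'.dom; have d₅ := hf'.cod; have d₆ := hg'.dom
    simp only [hm, hl', List.length_append, List.length_cons] at d₁ d₂ d₃ d₄ d₅ d₆
    refine ⟨_, hf'.comp hg', ?_⟩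
    rw [comp_assoc (by omega) (by simp; omega), eg,
      ← comp_assoc (by simp; omega) (by simp; omega), ef,
      comp_assoc (by simp; omega) (by simp; omega), mul_comp_right _ _ (by omega)]
  | @mul f g l m l' m' E₁ E₂ hf hg ihf ihg =>
    -- The wire must enter and leave in the same factor: in the mixed cases conservation would make
    -- both factors produce `x`.
    rcases List.append_eq_append_cons hl with ⟨q₁, rfl, rfl⟩ | ⟨p₂, rfl, rfl⟩ <;>
    rcases List.append_eq_append_cons hl' with ⟨q₂, rfl, rfl⟩ | ⟨p₃, rfl, rfl⟩
    · obtain ⟨f', hf', ef⟩ := ihf hG.append_left rfl rfl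
      refine ⟨f' * g, by simpa using hf'.mul hg, ?_⟩
      have := mul_comp_pull_left (g := g) ef (by rw [hf.cod]; simp; omega)
        (by rw [hf'.dom]; simp)
      simpa [hg.dom, hg.cod] using this
    · refine (hG.append_disjoint (x := x) (by simp) ?_).elim
      rw [hg.conservation]; simp
    · refine (hG.append_disjoint (x := x) ?_ (by simp)).elim
      rw [hf.conservation]; simp
    · obtain ⟨g', hg', eg⟩ := ihg hG.append_right rfl rfl
      refine ⟨f * g', by simpa using hf.mul hg', ?_⟩
      have := mul_comp_pull_right (f := f) eg (by rw [hg.cod]; simp; omega)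
        (by rw [hg'.dom]; simp) (by rw [hg'.cod]; simp)
      simpa [hf.dom, hf.cod] using this

/-- A box and an arrow beside it can be exchanged. -/
theorem one_mul_comp_box (h : Realizes G f l E l') (e : G.Edge) :
    (Arr.one _ (G.src e).length * f) ⬝
        (⟨_, _, freeGen (G.label e)⟩ * Arr.one _ l'.length) =
      (⟨_, _, freeGen (G.label e)⟩ * Arr.one _ l.length) ⬝
        (Arr.one _ (G.tgt e).length * f) := by
  rw [← h.dom, ← h.cod, G.length_src, G.length_tgt]
  exact (mul_eq_right_comp (X := freeProp S) ⟨_, _, freeGen (G.label e)⟩ f).symm.trans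
    (mul_eq_left_comp _ _)

/-! ### Arrows without boxes. -/

/-- Without boxes the outputs permute the inputs, so every intermediate list in the derivation is
empty too and only identities on `0` are composed. -/
theorem eq_one_of_nil (h : Realizes G f l E l') (hE : E = 0) (hl : l = []) : f = 1 := by
  induction h with
  | gen e => simp at hE
  | one l => subst hl; rfl
  | swap l l' =>
    obtain ⟨rfl, rfl⟩ := List.append_eq_nil_iff.1 hl
    exact swap_zero_right 0
  | @comp f g l m l' E₁ E₂ hf hg ihf ihg =>
    obtain ⟨rfl, rfl⟩ := add_eq_zero.1 hE
    subst hl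
    rw [ihf rfl rfl, ihg rfl hf.perm.nil_eq.symm, ← one_zero, one_comp_one]
  | mul _ _ ihf ihg =>
    obtain ⟨rfl, rfl⟩ := add_eq_zero.1 hE
    obtain ⟨rfl, rfl⟩ := List.append_eq_nil_iff.1 hl
    rw [ihf rfl rfl, ihg rfl rfl, _root_.mul_one]

/-- Arrows without boxes are determined by how they connect pairwise distinct nodes. -/
theorem eq_of_noEdges (hf : Realizes G f l 0 l') (hg : Realizes G g l 0 l') (hl : l.Nodup) :
    f = g := by
  induction l' generalizing f g l with
  | nil =>
    have hl := hf.perm.eq_nil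
    rw [hf.eq_one_of_nil rfl hl, hg.eq_one_of_nil rfl hl]
  | cons x l' ih =>
    obtain ⟨p, q, rfl⟩ := List.append_of_mem (hf.perm.mem_iff.2 List.mem_cons_self)
    have hG : G.Fresh (p ++ x :: q) 0 := by simpa [Hyp.Fresh] using hl
    -- Since `x` is the first output, the `pull` on the output side is an identity. The one on the
    -- input side depends only on the position of `x` in the inputs, so it is the same for `f` and
    -- `g`.
    obtain ⟨f', hf', ef⟩ := hf.exists_wire hG rfl (List.nil_append _).symm
    obtain ⟨g', hg', eg⟩ := hg.exists_wire hG rfl (List.nil_append _).symm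
    rw [List.length_nil, pull_zero, comp_one _ (by rw [hf.cod]; simp; omega)] at ef
    rw [List.length_nil, pull_zero, comp_one _ (by rw [hg.cod]; simp; omega)] at eg
    rw [ef, eg, ih hf' hg' (hl.sublist (by simp))]

theorem exists_of_perm (h : l.Perm l') : ∃ f, Realizes G f l 0 l' := by
  induction h with
  | nil => exact ⟨_, .one []⟩
  | cons x _ ih =>
    obtain ⟨f, hf⟩ := ih
    exact ⟨_, hf.cons x⟩
  | swap x y l => exact ⟨_, .mul_one l (.swap [y] [x])⟩
  | trans _ _ ih ih' =>
    obtain ⟨f, hf⟩ := ih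
    obtain ⟨g, hg⟩ := ih'
    exact ⟨_, hf.zero_comp hg⟩

/-- Several wires without boxes can be split off at once. -/
theorem exists_wires {u r : List G.Node} (h : Realizes G f l E (u ++ r)) (hG : G.Fresh l E)
    (hu : u ⊆ l) : ∃ π f' r', Realizes G π l 0 (u ++ r') ∧ Realizes G f' r' E r ∧
      f = π ⬝ (Arr.one _ u.length * f') := by
  induction u generalizing f l with
  | nil =>
    refine ⟨_, f, l, .one l, h, ?_⟩
    rw [List.length_nil, one_zero, _root_.one_mul, one_comp _ h.dom]
  | cons x u ih =>
    obtain ⟨p, q, rfl⟩ := List.append_of_mem (hu List.mem_cons_self)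
    obtain ⟨f₁, hf₁, ef⟩ := h.exists_wire hG rfl (List.nil_append _).symm
    have hG' : G.Fresh (p ++ q) E := hG.of_le (by
      gcongr; exact Multiset.coe_le.2 (List.Sublist.subperm (by simp)))
    -- Outputs are distinct, so `x ∉ u` and the rest of `u` survives the removal of `x` from the
    -- inputs.
    have hx := (List.nodup_cons.1 (hG.nodup_cod h)).1
    obtain ⟨π, f', r', hπ, hf', rfl⟩ := ih hf₁ hG' (fun y hy => by
      have := hu (List.mem_cons_of_mem _ hy)
      simp only [List.mem_append, List.mem_cons] at this ⊢
      rcases this with h | rfl | h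
      · exact .inl h
      · exact (hx (by simp [hy])).elim
      · exact .inr h)
    refine ⟨_, f', r', (Realizes.pull p q x).zero_comp (hπ.cons x), hf', ?_⟩
    rw [List.length_nil, pull_zero, comp_one _ (by rw [h.cod]; simp; omega)] at ef
    have d₁ := hπ.dom; have d₂ := hπ.cod; have d₃ := hf'.dom
    simp only [List.length_append] at d₁ d₂ d₃
    rw [ef, mul_comp_right _ _ (by simp; omega), comp_assoc (by simp; omega) (by simp; omega),
      ← mul_assoc, one_mul_one, List.length_cons, Nat.add_comm 1]

/-! ### Moving a box to the front. -/

/-- A box all of whose inputs are inputs of the diagram can be moved to the front. -/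
theorem exists_box (h : Realizes G f l E l') (hG : G.Fresh l E) {e : G.Edge} (he : e ∈ E)
    (hs : G.src e ⊆ l) : ∃ E' r π f', E = e ::ₘ E' ∧ Realizes G π l 0 (G.src e ++ r) ∧
      Realizes G f' (G.tgt e ++ r) E' l' ∧
      f = π ⬝ (⟨_, _, freeGen (G.label e)⟩ * Arr.one _ r.length) ⬝ f' := by
  induction h with
  | gen e' =>
    obtain rfl := Multiset.mem_singleton.1 he
    refine ⟨0, [], _, _, rfl, by simpa using .one (G.src e), by simpa using .one (G.tgt e), ?_⟩
    rw [List.length_nil, one_zero, _root_.mul_one, one_comp _ (by simp [G.length_src]),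
      comp_one _ (by simp [G.length_tgt])]
  | one l => simp at he
  | swap l l' => simp at he
  | @comp f g l m l' E₁ E₂ hf hg ihf ihg =>
    rcases Multiset.mem_add.1 he with he | he
    · obtain ⟨E', r, π, f', rfl, hπ, hf', rfl⟩ := ihf hG.left he hs
      refine ⟨E' + E₂, r, π, _, Multiset.cons_add _ _ _, hπ, hf'.comp hg, ?_⟩
      have d₁ := hπ.cod; have d₂ := hf'.dom; have d₃ := hf'.cod; have d₄ := hg.dom
      have d₅ := G.length_src e; have d₆ := G.length_tgt e
      simp only [List.length_append] at d₁ d₂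
      rw [comp_assoc (by rw [comp_cod (by simp; omega)]; simp; omega) (by omega)]
    -- The box consumes its sources inside `g`; being inputs of the whole diagram, they are not
    -- targets, so they enter `g` through `m`.
    · have hs' : G.src e ⊆ m := fun x hx => by
        have h₁ : x ∈ (m : Multiset G.Node) + G.targets E₂ := by
          rw [hg.conservation]; simp [Hyp.mem_sources he hx]
        rcases Multiset.mem_add.1 h₁ with h₁ | h₁
        · simpa using h₁
        · exact (hG.disjoint (hs hx) (by simp [h₁])).elim
      obtain ⟨E', r, π, g', rfl, hπ, hg', rfl⟩ := ihg (hG.right hf) he hs'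
      -- The sources of `e` cross `f ⬝ π` as bare wires. Once they are split off, the rest `f'` lies
      -- beside the box and can be exchanged with it.
      obtain ⟨ρ, f', r', hρ, hf', e'⟩ := (hf.comp_zero hπ).exists_wires hG.left hs
      refine ⟨E₁ + E', r', ρ, _, Multiset.add_cons _ _ _, hρ,
        (hf'.one_mul (G.tgt e)).comp hg', ?_⟩
      have d₁ := hπ.cod; have d₂ := hf'.dom; have d₃ := hf'.cod; have d₄ := hρ.cod
      have d₅ := G.length_src e; have d₆ := G.length_tgt e; have d₇ := hf.cod; have d₈ := hπ.dom
      have d₉ := hg'.dom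
      simp only [List.length_append] at d₁ d₄ d₉
      rw [← comp_assoc (f := f) (by rw [comp_dom]; omega)
          (by rw [comp_cod (by simp; omega)]; simp; omega),
        ← comp_assoc (f := f) (by omega) (by simp; omega), e',
        comp_assoc (f := ρ) (by simp; omega) (by simp; omega), hf'.one_mul_comp_box,
        ← comp_assoc (f := ρ) (by simp; omega) (by simp; omega),
        comp_assoc (by rw [comp_cod (by simp; omega)]; simp; omega) (by simp; omega)]
  | @mul f g l m l' m' E₁ E₂ hf hg ihf ihg =>
    have hx : ∀ x ∈ G.src e, x ∉ G.targets (E₁ + E₂) := fun x hx => hG.disjoint (hs hx)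
    rcases Multiset.mem_add.1 he with he | he
    · have hs' : G.src e ⊆ l := fun x hx' => by
        have h₁ : x ∈ (l : Multiset G.Node) + G.targets E₁ := by
          rw [hf.conservation]; simp [Hyp.mem_sources he hx']
        rcases Multiset.mem_add.1 h₁ with h₁ | h₁
        · simpa using h₁
        · exact (hx x hx' (by simp [h₁])).elim
      obtain ⟨E', r, π, f', rfl, hπ, hf', rfl⟩ := ihf hG.append_left he hs'
      refine ⟨E' + E₂, r ++ m, _, f' * g, Multiset.cons_add _ _ _,
        by simpa using hπ.mul_one m, by simpa using hf'.mul hg, ?_⟩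
      have d₁ := hπ.cod; have d₂ := hf'.dom; have d₄ := hg.dom
      have d₅ := G.length_src e; have d₆ := G.length_tgt e
      simp only [List.length_append] at d₁ d₂
      rw [List.length_append, ← one_mul_one, ← mul_assoc, mul_comp_mul (by simp; omega) rfl,
        one_comp_one, mul_comp_mul (by rw [comp_cod (by simp; omega)]; simp; omega)
          (by simpa using d₄.symm), one_comp _ d₄]
    · have hs' : G.src e ⊆ m := fun x hx' => by
        have h₁ : x ∈ (m : Multiset G.Node) + G.targets E₂ := by
          rw [hg.conservation]; simp [Hyp.mem_sources he hx']
        rcases Multiset.mem_add.1 h₁ with h₁ | h₁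
        · simpa using h₁
        · exact (hx x hx' (by simp [h₁])).elim
      obtain ⟨E', r, π, g', rfl, hπ, hg', rfl⟩ := ihg hG.append_right he hs'
      -- The box comes first in its own factor but behind the wires `l`. Its sources are carried in
      -- front of `l`, and its targets back behind.
      have s₁ : Realizes G (Arr.swap _ l.length (G.src e).length * Arr.one _ r.length)
          (l ++ (G.src e ++ r)) 0 (G.src e ++ (l ++ r)) := by
        simpa using (Realizes.swap l (G.src e)).mul_one r
      have s₂ : Realizes G (Arr.swap _ (G.tgt e).length l.length * Arr.one _ r.length)
          (G.tgt e ++ (l ++ r)) 0 (l ++ (G.tgt e ++ r)) := by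
        simpa using (Realizes.swap (G.tgt e) l).mul_one r
      refine ⟨E₁ + E', l ++ r, _, _, Multiset.add_cons _ _ _, (hπ.one_mul l).zero_comp s₁,
        s₂.zero_comp (hf.mul hg'), ?_⟩
      have d₁ := hπ.cod; have d₂ := hg'.dom; have d₃ := hπ.dom; have d₄ := hf.dom
      have d₅ := G.length_src e; have d₆ := G.length_tgt e
      simp only [List.length_append] at d₁ d₂
      have key : (Arr.swap _ l.length (G.src e).length * Arr.one _ r.length) ⬝
            ((⟨_, _, freeGen (G.label e)⟩ : Arr (freeProp S)) *
              Arr.one _ (l ++ r).length) ⬝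
            (Arr.swap _ (G.tgt e).length l.length * Arr.one _ r.length) =
          Arr.one _ l.length *
            ((⟨_, _, freeGen (G.label e)⟩ : Arr (freeProp S)) * Arr.one _ r.length) := by
        have h := mul_comp_swap (Arr.one (freeProp S) l.length) ⟨_, _, freeGen (G.label e)⟩
        simp only [one_dom, one_cod, ← d₅, ← d₆] at h
        rw [List.length_append, ← one_mul_one, ← mul_assoc, mul_comp_mul (by simp [d₅]) rfl, ← h,
          mul_comp_mul (by rw [comp_cod (by simp [d₆])]; simp) (by simp [one_comp_one]),
          comp_assoc (by simp [d₆]) (by simp), swap_comp_swap, comp_one _ (by simp [d₆]),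
          one_comp_one, one_comp_one, mul_assoc]
      rw [← comp_assoc (h := f * g')
          (by rw [comp_cod (by rw [comp_cod (by simp; omega)]; simp; omega)]; simp; omega)
          (by simp; omega),
        comp_assoc (f := Arr.one _ l.length * π) (by simp; omega) (by simp; omega),
        comp_assoc (f := Arr.one _ l.length * π)
          (by simp; omega) (by rw [comp_cod (by simp; omega)]; simp; omega), key,
        mul_comp_mul rfl (by simp; omega), one_comp_one,
        mul_comp_mul (by simp; omega) (by rw [comp_cod (by simp; omega)]; simp; omega),
        one_comp _ d₄]

/-- Diagrams built by `⬝` and `*` are acyclic, so some box comes first. In a composite it is found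
in the second factor only if the first has no boxes, and then the first merely permutes the inputs.
-/
theorem exists_first_box (h : Realizes G f l E l') (hE : E ≠ 0) : ∃ e ∈ E, G.src e ⊆ l := by
  induction h with
  | gen e => exact ⟨e, by simp, List.Subset.refl _⟩
  | one l => simp at hE
  | swap l l' => simp at hE
  | @comp f g l m l' E₁ E₂ hf hg ihf ihg =>
    by_cases h₁ : E₁ = 0
    · subst h₁
      obtain ⟨e, he, hs⟩ := ihg (by simpa using hE)
      exact ⟨e, by simpa using he, fun x hx => hf.perm.mem_iff.2 (hs hx)⟩
    · obtain ⟨e, he, hs⟩ := ihf h₁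
      exact ⟨e, by simp [he], hs⟩
  | @mul f g l m l' m' E₁ E₂ hf hg ihf ihg =>
    by_cases h₁ : E₁ = 0
    · subst h₁
      obtain ⟨e, he, hs⟩ := ihg (by simpa using hE)
      exact ⟨e, by simpa using he, fun x hx => List.mem_append_right _ (hs hx)⟩
    · obtain ⟨e, he, hs⟩ := ihf h₁
      exact ⟨e, by simp [he], fun x hx => List.mem_append_left _ (hs hx)⟩

/-! ### Uniqueness of the arrow with a given realization. -/

/-- Arrows of the free PROP are determined by their realizations. -/
theorem eq_of_fresh (hf : Realizes G f l E l') (hg : Realizes G g l E l') (hG : G.Fresh l E) :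
    f = g := by
  induction hn : E.card generalizing f g l E with
  | zero =>
    obtain rfl := Multiset.card_eq_zero.1 hn
    exact hf.eq_of_noEdges hg hG.nodup
  | succ n ih =>
    obtain ⟨e, he, hs⟩ := hf.exists_first_box (E := E) (by rintro rfl; simp at hn)
    obtain ⟨E', r, π, f', rfl, hπ, hf', rfl⟩ := hf.exists_box hG he hs
    obtain ⟨E'', r', π', g', hE, hπ', hg', rfl⟩ := hg.exists_box hG he hs
    obtain rfl := Multiset.cons_inj_right e |>.1 hE
    -- The wires `r` and `r'` beside the box are both what remains of `l` without the sources of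
    -- `e`, so they differ by a permutation, realized by `ρ`.
    obtain ⟨ρ, hρ⟩ := exists_of_perm
      ((List.perm_append_left_iff _).1 (hπ.perm.symm.trans hπ'.perm))
    have hG' : G.Fresh (G.tgt e ++ r) E' := by
      refine hG.of_le ?_
      rw [Multiset.coe_eq_coe.2 hπ.perm, Hyp.targets_cons, ← Multiset.coe_add,
        ← Multiset.coe_add, add_assoc, add_assoc, add_left_comm (r : Multiset G.Node)]
      exact Multiset.le_add_left _ _
    -- The permutation `ρ` is appended to `π` before the box and prepended to `g'` after it;
    -- exchanging it with the box identifies the two factorizations.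
    have e₁ := hπ'.eq_of_noEdges (hπ.zero_comp (hρ.one_mul _)) hG.nodup
    have e₂ := ih hf' ((hρ.one_mul _).zero_comp hg') hG' (by simpa using hn)
    have d₁ := hπ.cod; have d₂ := hρ.dom; have d₃ := hρ.cod; have d₄ := hg'.dom
    have d₅ := G.length_src e; have d₆ := G.length_tgt e
    simp only [List.length_append] at d₁ d₄
    rw [e₁, e₂, comp_assoc (f := π) (g := Arr.one _ _ * ρ) (by simp; omega) (by simp; omega),
      hρ.one_mul_comp_box, ← comp_assoc (h := g') (by rw [comp_cod (by simp; omega)]; simp; omega)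
        (by simp; omega),
      comp_assoc (f := π) (h := Arr.one _ _ * ρ) (by simp; omega) (by simp; omega)]

end Realizes
/-! ## The cospan of a term -/

open Hyp

/-- The string diagram of a term. -/
def Term.cospan : {a b : ℕ} → Term S a b → Cospan S a b
  | _, _, .gen o => Cospan.gen o
  | _, _, .id n => Cospan.id S n
  | _, _, .symm n m => Cospan.symm S n m
  | _, _, .comp t t' => Cospan.comp t.cospan t'.cospan
  | _, _, .tensor t t' => Cospan.tensor t.cospan t'.cospan

/-- A concrete cospan representing the interpretation gives a hypergraph in which `t` can be traced.
-/
theorem interp_mk {a b : ℕ} (t : Term S a b) :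
    (interp S).map (X := freeProp S) (FreeHom.mk t) = FTermHom.mk t.cospan := by
  induction t with
  | gen o => rfl
  | id n => rfl
  | symm n m => rfl
  | comp t t' ih ih' =>
    refine ((interp S).map_comp (FreeHom.mk t) (FreeHom.mk t')).trans ?_
    rw [ih, ih']
    rfl
  | tensor t t' ih ih' =>
    refine ((interp S).map_tensor (FreeHom.mk t) (FreeHom.mk t')).trans ?_
    rw [ih, ih']
    rfl

/-! ### Realizations and freshness under morphisms, gluing and disjoint union. -/

theorem Realizes.map {G H : Hyp S} (φ : G ⟶ H) {f : Arr (freeProp S)} {l l' : List G.Node}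
    {E : Multiset G.Edge} (h : Realizes G f l E l') :
    Realizes H f (l.map (Hom.node φ)) (E.map (Hom.edge φ)) (l'.map (Hom.node φ)) := by
  induction h with
  | gen e =>
    have h := Realizes.gen (G := H) (Hom.edge φ e)
    rw [Hom.src_edge, Hom.tgt_edge, Hom.label_edge] at h
    exact h
  | one l => exact Realizes.of_eq_length (by simp)
  | swap l l' =>
    have h := Realizes.swap (l.map (Hom.node φ)) (l'.map (Hom.node φ))
    simpa using h
  | comp _ _ ihf ihg =>
    rw [Multiset.map_add]
    exact ihf.comp ihg
  | mul _ _ ihf ihg =>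
    rw [Multiset.map_add, List.map_append, List.map_append]
    exact ihf.mul ihg

theorem Hyp.targets_map {G H : Hyp S} (φ : G ⟶ H) (E : Multiset G.Edge) :
    H.targets (E.map (Hom.edge φ)) = (G.targets E).map (Hom.node φ) := by
  simp [Hyp.targets, Multiset.bind_map, Multiset.map_bind, Hom.tgt_edge]

/-- The input or output nodes of a cospan, in order. -/
def Hyp.nodes {n : ℕ} {G : Hyp S} (f : discrete S n ⟶ G) : List G.Node :=
  List.ofFn (n := n) (Hom.node f)

@[simp] theorem Hyp.length_nodes {n : ℕ} {G : Hyp S} (f : discrete S n ⟶ G) :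
    (nodes f).length = n := List.length_ofFn

theorem Hyp.nodes_comp {n : ℕ} {G H : Hyp S} (f : discrete S n ⟶ G) (g : G ⟶ H) :
    nodes (f ≫ g) = (nodes f).map (Hom.node g) :=
  (List.map_ofFn (f := fun i : Fin n => Hom.node f i) (g := Hom.node g)).symm

theorem Hyp.nodes_copair {n m : ℕ} {G : Hyp S} (f : discrete S n ⟶ G) (g : discrete S m ⟶ G) :
    nodes (copair f g) = nodes f ++ nodes g := by
  refine List.ofFn_add.trans ?_
  congr 1 <;> refine congrArg List.ofFn (funext fun i => ?_)
  · exact Fin.addCases_left (motive := fun _ => G.Node) i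
  · exact Fin.addCases_right (motive := fun _ => G.Node) i

theorem Hyp.nodes_id (n m : ℕ) :
    nodes (𝟙 (discrete S (n + m))) = nodes (blockL S n m) ++ nodes (blockR S n m) := by
  rw [← nodes_copair]
  congr 1
  apply block_hom_ext <;> simp

theorem _root_.Multiset.nodup_map_inl_add_map_inr {α β : Type*} {s : Multiset α}
    {t : Multiset β} (hs : s.Nodup) (ht : t.Nodup) :
    (s.map (Sum.inl : α → α ⊕ β) + t.map Sum.inr).Nodup := by
  refine Multiset.nodup_add.2 ⟨hs.map Sum.inl_injective, ht.map Sum.inr_injective, ?_⟩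
  rw [Multiset.disjoint_left]
  intro x hx hx'
  obtain ⟨y, -, rfl⟩ := Multiset.mem_map.1 hx
  obtain ⟨z, -, h⟩ := Multiset.mem_map.1 hx'
  cases h

/-- Gluing creates no coincidences among the nodes that count: the glued nodes of `H` are its
inputs, and they are distinct and disjoint from the targets of `F`. The leg `p` need not be
injective. -/
theorem Hyp.fresh_glue {n : ℕ} {G H : Hyp S} (p : discrete S n ⟶ G) (q : discrete S n ⟶ H)
    {l : List G.Node} {E : Multiset G.Edge} {F : Multiset H.Edge} (hG : G.Fresh l E)
    (hH : H.Fresh (nodes q) F) :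
    (glue p q).Fresh (l.map (Hom.node (glueInl p q)))
      (E.map (Hom.edge (glueInl p q)) + F.map (Hom.edge (glueInr p q))) := by
  classical
  have hq : Function.Injective (Hom.node q) := List.nodup_ofFn.1 hH.nodup
  -- A glued node of `H` is sent to its partner in `G`, well defined because `q` is injective. It
  -- suffices that the images under `r` are distinct: nodes of `G` land on the left, targets of `F`
  -- on the right.
  let r : (glue p q).Node → G.Node ⊕ H.Node := Quot.lift
    (Sum.elim Sum.inl fun z => if h : ∃ i, Hom.node q i = z then .inl (Hom.node p h.choose)
      else .inr z) (by
    rintro _ _ ⟨i⟩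
    have h : ∃ j, Hom.node q j = Hom.node q i := ⟨i, rfl⟩
    simp only [Sum.elim_inl, Sum.elim_inr, dif_pos h]
    rw [hq h.choose_spec])
  refine Multiset.Nodup.of_map r ?_
  have hl : ∀ x, r (Hom.node (glueInl p q) x) = Sum.inl x := fun x => rfl
  have hr : ∀ z ∈ H.targets F, r (Hom.node (glueInr p q) z) = Sum.inr z := fun z hz =>
    dif_neg fun ⟨i, hi⟩ => hH.disjoint (x := z) (List.mem_ofFn.2 ⟨i, hi⟩) hz
  rw [Hyp.targets_add, Hyp.targets_map, Hyp.targets_map, ← Multiset.map_coe, ← add_assoc,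
    ← Multiset.map_add, Multiset.map_add, Multiset.map_map, Multiset.map_map,
    Multiset.map_congr (f := r ∘ Hom.node (glueInl p q)) (g := Sum.inl) rfl (fun x _ => hl x),
    Multiset.map_congr (f := r ∘ Hom.node (glueInr p q)) (g := Sum.inr) rfl hr]
  exact Multiset.nodup_map_inl_add_map_inr hG (Multiset.nodup_add.1 hH).2.1

theorem Hyp.fresh_sum {G H : Hyp S} {l : List G.Node} {m : List H.Node} {E : Multiset G.Edge}
    {F : Multiset H.Edge} (hG : G.Fresh l E) (hH : H.Fresh m F) :
    (sum G H).Fresh (l.map (Hom.node (sumInl G H)) ++ m.map (Hom.node (sumInr G H)))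
      (E.map (Hom.edge (sumInl G H)) + F.map (Hom.edge (sumInr G H))) := by
  unfold Hyp.Fresh
  rw [Hyp.targets_add, Hyp.targets_map, Hyp.targets_map, ← Multiset.coe_add, ← Multiset.map_coe,
    ← Multiset.map_coe, add_add_add_comm, ← Multiset.map_add, ← Multiset.map_add]
  exact Multiset.nodup_map_inl_add_map_inr hG hH

theorem Hyp.nodes_nodup {n : ℕ} {G : Hyp S} {f : discrete S n ⟶ G}
    (hf : Function.Injective (Hom.node f)) : (nodes f).Nodup :=
  List.nodup_ofFn.2 hf

theorem Hyp.fresh_zero {G : Hyp S} {l : List G.Node} (h : l.Nodup) : G.Fresh l 0 := by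
  unfold Hyp.Fresh
  rwa [Hyp.targets_zero, add_zero, Multiset.coe_nodup]

/-! ### Realizing terms in their cospans, and faithfulness. -/

/-- A term is realized in its own string diagram, with every hyperedge used exactly once. -/
theorem Term.exists_realizes {a b : ℕ} (t : Term S a b) :
    ∃ E : Multiset t.cospan.apex.Edge, E.Nodup ∧ (∀ e, e ∈ E) ∧
      t.cospan.apex.Fresh (nodes t.cospan.left) E ∧
      Realizes t.cospan.apex ⟨a, b, FreeHom.mk t⟩ (nodes t.cospan.left) E
        (nodes t.cospan.right) := by
  induction t with
  | gen o =>
    let e : (Cospan.gen o).apex.Edge := ()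
    refine ⟨{e}, Multiset.nodup_singleton _, fun _ => Multiset.mem_singleton_self _, ?_,
      Realizes.gen e⟩
    change (((nodes (Cospan.gen o).left : List _) : Multiset (Cospan.gen o).apex.Node) +
      (Cospan.gen o).apex.targets {e}).Nodup
    rw [Hyp.targets_singleton]
    have h := Multiset.nodup_map_inl_add_map_inr 
      (Multiset.coe_nodup.2 (List.nodup_finRange (S.arity o)))
      (Multiset.coe_nodup.2 (List.nodup_finRange (S.coarity o)))
    rw [Multiset.map_coe, Multiset.map_coe, ← List.ofFn_eq_map, ← List.ofFn_eq_map] at h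
    exact h
  | id n =>
    refine ⟨0, Multiset.nodup_zero, fun e => Empty.elim e, ?_, ?_⟩
    · exact fresh_zero (nodes_nodup Function.injective_id)
    · exact Realizes.of_eq_length (by simp)
  | symm n m =>
    refine ⟨0, Multiset.nodup_zero, fun e => Empty.elim e, ?_, ?_⟩
    · refine fresh_zero (nodes_nodup (Function.LeftInverse.injective (g := Hom.node (Hyp.swap S m n))
        fun i => ?_))
      exact congrFun (congrArg Hom.node (swap_swap n m)) i
    -- The apex has `m + n` nodes and the right leg is the identity, so the first `n` inputs lie on
    -- the last block and the other `m` on the first.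
    · have h := Realizes.swap (nodes (blockR S m n)) (nodes (blockL S m n))
      rw [← nodes_copair, ← nodes_id, length_nodes, length_nodes] at h
      exact h
  | comp t t' ih ih' =>
    obtain ⟨E, hn, hE, hG, h⟩ := ih
    obtain ⟨E', hn', hE', hG', h'⟩ := ih'
    refine ⟨E.map Sum.inl + E'.map Sum.inr, Multiset.nodup_map_inl_add_map_inr hn hn', ?_, ?_, ?_⟩
    · rintro (e | e)
      · exact Multiset.mem_add.2 (.inl (Multiset.mem_map_of_mem _ (hE e)))
      · exact Multiset.mem_add.2 (.inr (Multiset.mem_map_of_mem _ (hE' e)))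
    · have := fresh_glue t.cospan.right t'.cospan.left hG hG'
      rw [← nodes_comp] at this
      exact this
    · have h₁ := h.map (glueInl t.cospan.right t'.cospan.left)
      have h₂ := h'.map (glueInr t.cospan.right t'.cospan.left)
      rw [← nodes_comp, ← nodes_comp] at h₁ h₂
      -- In the pushout the outputs of `t` and the inputs of `t'` become the same list of nodes.
      rw [(isPushout_glue _ _).w] at h₁
      have h₃ := h₁.comp h₂
      rw [mk_comp_mk (X := freeProp S) (FreeHom.mk t) (FreeHom.mk t')] at h₃
      exact h₃
  | tensor t t' ih ih' =>
    obtain ⟨E, hn, hE, hG, h⟩ := ih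
    obtain ⟨E', hn', hE', hG', h'⟩ := ih'
    refine ⟨E.map Sum.inl + E'.map Sum.inr, Multiset.nodup_map_inl_add_map_inr hn hn', ?_, ?_, ?_⟩
    · rintro (e | e)
      · exact Multiset.mem_add.2 (.inl (Multiset.mem_map_of_mem _ (hE e)))
      · exact Multiset.mem_add.2 (.inr (Multiset.mem_map_of_mem _ (hE' e)))
    · have := fresh_sum hG hG'
      rw [← nodes_comp, ← nodes_comp, ← nodes_copair] at this
      exact this
    · have h₃ := (h.map (sumInl _ t'.cospan.apex)).mul (h'.map (sumInr t.cospan.apex _))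
      rw [← nodes_comp, ← nodes_comp, ← nodes_comp, ← nodes_comp, ← nodes_copair,
        ← nodes_copair] at h₃
      exact h₃

theorem interp_faithful (S : Signature.{u}) : (interp S).Faithful := by
  rintro n m ⟨t⟩ ⟨t'⟩ h
  change (interp S).map (X := freeProp S) (FreeHom.mk t) = (interp S).map (FreeHom.mk t') at h
  rw [interp_mk, interp_mk] at h
  obtain ⟨φ, hl, hr⟩ := Quotient.exact h
  obtain ⟨E, hn, hE, hG, h⟩ := t.exists_realizes
  obtain ⟨E', hn', hE', hG', h'⟩ := t'.exists_realizes
  have hi : Function.Injective (Hom.edge φ.hom) :=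
    Function.LeftInverse.injective (g := Hom.edge φ.inv)
      fun e => congrFun (congrArg Hom.edge φ.hom_inv_id) e
  -- Both multisets contain every hyperedge exactly once, so the bijection on hyperedges matches
  -- them.
  have hEE' : E.map (Hom.edge φ.hom) = E' := by
    refine ((hn.map hi).ext hn').2 fun e => ⟨fun _ => hE' e, fun _ => ?_⟩
    exact Multiset.mem_map.2 ⟨Hom.edge φ.inv e, hE _,
      congrFun (congrArg Hom.edge φ.inv_hom_id) e⟩
  have h := h.map φ.hom
  rw [← nodes_comp, ← nodes_comp, hl, hr, hEE'] at h
  exact eq_of_heq (Arr.mk.inj (h.eq_of_fresh h' hG')).2.2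

end StringDiagram

theorem mainTheorem5 (S : StringDiagram.Signature.{u}) :
    (StringDiagram.interp S).Faithful := by
  exact StringDiagram.interp_faithful S
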